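/- Let $V$ be a finite-dimensional complex vector space and $G\le GL(V)$ a non-trivial finite group that acts irreducibly on $V$ and is generated by the set $\mathcal S=\{s\in G:\dim(1-s)V=1\}$ of its complex reflections. For every $s\in\mathcal S$ choose $\alpha_s\in V^*$, $\check\alpha_s\in V$ with $s(v)=v-\langle\alpha_s,v\rangle\check\alpha_s$ for all $v\in V$. Let $\mathbb C(\mathcal S)^G$ be the space of functions $c:\mathcal S\to\mathbb C$, $s\mapsto c_s$, with $c_{gsg^{-1}}=c_s$ for all $g\in G$. For $t\in\mathbb C$ and $c\in\mathbb C(\mathcal S)^G$, the rational Cherednik algebra $H_{t,c}(G)$ is the algebra generated by $V$, $\mathbb CG$ and $V^*$ with relations (besides those of $\mathbb CG$) $[v,v']=0$, $[f,f']=0$, $gv=g(v)g$, $gf=g(f)g$ and $[f,v]=t\langle f,v\rangle\cdot 1+\sum_{s\in\mathcal S}c_s\langle f,(1-s)v\rangle\, s$, for $v,v'\in V$, $f,f'\in V^*$, $g\in G$. Let $Y_G$ be the vector space with basis $\{[s]:s\in\mathcal S\}$, with $G$-action $g([s])=\lambda(g,s)[gsg^{-1}]$, where $g(\check\alpha_s)=\lambda(g,s)\check\alpha_{gsg^{-1}}$,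 and braiding $\Psi([r]\otimes[s])=r([s])\otimes[r]$. Let $Y_G^*$ be the dual $G$-module, with dual basis $[s]^*$ and with the adjoint braiding $\Psi^*$ (with respect to $\langle f\otimes g,v\otimes w\rangle=\langle f,v\rangle\langle g,w\rangle$). For $t'\in\mathbb C$, the deformed quadratic braided double $\mathcal H_{t'}(Y_G)$ is the algebra generated by $Y_G$, $\mathbb CG$ and $Y_G^*$ with relations (besides those of $\mathbb CG$) $\ker(\mathrm{id}+\Psi)\cap\wedge^2Y_G$, $\ker(\mathrm{id}+\Psi^*)\cap\wedge^2Y_G^*$, $g\cdot[s]=g([s])\cdot g$, $g\cdot[s]^*=g([s]^*)\cdot g$, and $[r]^*[s]-[s][r]^*$ equal to $s+t'\cdot 1$ if $r=s$ and to $0$ if $r\ne s$. Here $\wedge^2$ denotes the skew-symmetric tensors in the tensor square. Let $M_c: V\oplus\mathbb CG\oplus V^*\to Y_G\oplus\mathbb CG\oplus Y_G^*$ be the linear map $$M_c(v)=\sum_{s\in\mathcal S}c_s\langle\alpha_s,v\rangle[s],\qquad M_c(g)=g,\qquad M_c(f)=\sum_{s\in\mathcal S}\langle f,\check\alpha_s\rangle[s]^*.$$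 Then there is a non-zero linear functional $\kappa$ on $\mathbb C(\mathcal S)^G$ with $\sum_{s\in\mathcal S}c_s(1-s)v=\kappa(c)v$ for all $c\in\mathbb C(\mathcal S)^G$ and $v\in V$, and for every $t\ne0$ and every $c\in\mathbb C(\mathcal S)^G$ that is generic in the sense that $\kappa(c)\neq0$ (that is, $c$ lies outside the hyperplane $\ker\kappa$) there is $t'\in\mathbb C$, depending on $t$ and $c$, such that $M_c$ extends to an injective algebra homomorphism $H_{t,c}(G)\to\mathcal H_{t'}(Y_G)$. -/

import Mathlib

open scoped TensorProduct

noncomputable section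

namespace CherednikEmbedding

/-! ## Quadratic doubles over a group

`T²` of a module is written as `M ⊗[ℂ] M`. -/

section Double

variable {G : Type*} [Group G] {V : Type*} [AddCommGroup V] [Module ℂ V]

/-- The space of generators `V ⊕ ℂG ⊕ V*`. -/
abbrev Gens (G V : Type*) [Group G] [AddCommGroup V] [Module ℂ V] : Type _ :=
  V × MonoidAlgebra ℂ G × Module.Dual ℂ V

/-- A generator from `V`, in the tensor algebra of the space of generators. -/
def genV (G : Type*) [Group G] {V : Type*} [AddCommGroup V] [Module ℂ V] :
    V →ₗ[ℂ] TensorAlgebra ℂ (Gens G V) :=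
  TensorAlgebra.ι ℂ ∘ₗ LinearMap.inl ℂ V (MonoidAlgebra ℂ G × Module.Dual ℂ V)

/-- A generator from the group algebra. -/
def genG (V : Type*) [AddCommGroup V] [Module ℂ V] {G : Type*} [Group G] :
    MonoidAlgebra ℂ G →ₗ[ℂ] TensorAlgebra ℂ (Gens G V) :=
  TensorAlgebra.ι ℂ ∘ₗ LinearMap.inr ℂ V (MonoidAlgebra ℂ G × Module.Dual ℂ V) ∘ₗ
    LinearMap.inl ℂ (MonoidAlgebra ℂ G) (Module.Dual ℂ V)

/-- A generator from `V*`. -/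
def genD (G : Type*) [Group G] {V : Type*} [AddCommGroup V] [Module ℂ V] :
    Module.Dual ℂ V →ₗ[ℂ] TensorAlgebra ℂ (Gens G V) :=
  TensorAlgebra.ι ℂ ∘ₗ LinearMap.inr ℂ V (MonoidAlgebra ℂ G × Module.Dual ℂ V) ∘ₗ
    LinearMap.inr ℂ (MonoidAlgebra ℂ G) (Module.Dual ℂ V)

/-- For a linear map `j : M → A` into an algebra, the linear map `M ⊗ M → A`,
`m ⊗ m' ↦ j m * j m'`. -/
def quad {M A : Type*} [AddCommGroup M] [Module ℂ M] [Ring A] [Algebra ℂ A]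
    (j : M →ₗ[ℂ] A) : M ⊗[ℂ] M →ₗ[ℂ] A :=
  TensorProduct.lift ((LinearMap.mul ℂ A).compl₁₂ j j)

/-- The defining relations of the double with action `ρ`, commutator pairing `β` and spaces of
quadratic relations `Rm` and `Rp`. The group acts on `V*` contragrediently. -/
inductive DoubleRel (ρ : Representation ℂ G V)
    (β : Module.Dual ℂ V →ₗ[ℂ] V →ₗ[ℂ] MonoidAlgebra ℂ G)
    (Rm : Submodule ℂ (V ⊗[ℂ] V)) (Rp : Submodule ℂ (Module.Dual ℂ V ⊗[ℂ] Module.Dual ℂ V)) :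
    TensorAlgebra ℂ (Gens G V) → TensorAlgebra ℂ (Gens G V) → Prop
  | one : DoubleRel ρ β Rm Rp (genG V 1) 1
  | mul (a b : MonoidAlgebra ℂ G) : DoubleRel ρ β Rm Rp (genG V (a * b)) (genG V a * genG V b)
  | actV (g : G) (v : V) : DoubleRel ρ β Rm Rp
      (genG V (MonoidAlgebra.of ℂ G g) * genV G v)
      (genV G (ρ g v) * genG V (MonoidAlgebra.of ℂ G g))
  | actD (g : G) (f : Module.Dual ℂ V) : DoubleRel ρ β Rm Rp
      (genG V (MonoidAlgebra.of ℂ G g) * genD G f)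
      (genD G (ρ.dual g f) * genG V (MonoidAlgebra.of ℂ G g))
  | comm (f : Module.Dual ℂ V) (v : V) : DoubleRel ρ β Rm Rp
      (genD G f * genV G v - genV G v * genD G f) (genG V (β f v))
  | quadV (x : V ⊗[ℂ] V) (hx : x ∈ Rm) : DoubleRel ρ β Rm Rp (quad (genV G) x) 0
  | quadD (x : Module.Dual ℂ V ⊗[ℂ] Module.Dual ℂ V) (hx : x ∈ Rp) :
      DoubleRel ρ β Rm Rp (quad (genD G) x) 0

/-- The algebra generated by `V`, `ℂG` and `V*` subject to the relations `DoubleRel`. -/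
abbrev Double (ρ : Representation ℂ G V)
    (β : Module.Dual ℂ V →ₗ[ℂ] V →ₗ[ℂ] MonoidAlgebra ℂ G)
    (Rm : Submodule ℂ (V ⊗[ℂ] V))
    (Rp : Submodule ℂ (Module.Dual ℂ V ⊗[ℂ] Module.Dual ℂ V)) : Type _ :=
  RingQuot (DoubleRel ρ β Rm Rp)

/-- The canonical map from the space of generators to the double. -/
def Double.ι (ρ : Representation ℂ G V)
    (β : Module.Dual ℂ V →ₗ[ℂ] V →ₗ[ℂ] MonoidAlgebra ℂ G)
    (Rm : Submodule ℂ (V ⊗[ℂ] V))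
    (Rp : Submodule ℂ (Module.Dual ℂ V ⊗[ℂ] Module.Dual ℂ V)) :
    Gens G V →ₗ[ℂ] Double ρ β Rm Rp :=
  (RingQuot.mkAlgHom ℂ (DoubleRel ρ β Rm Rp)).toLinearMap ∘ₗ TensorAlgebra.ι ℂ

/-- Skew-symmetric tensors `∧²M ⊆ M ⊗ M`: the kernel of `id + τ`, with `τ` the flip. -/
def wedge (M : Type*) [AddCommGroup M] [Module ℂ M] : Submodule ℂ (M ⊗[ℂ] M) :=
  LinearMap.ker (LinearMap.id + (TensorProduct.comm ℂ M M).toLinearMap)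

end Double

/-! ## Complex reflections and roots -/

section Reflections

variable {V : Type*} [AddCommGroup V] [Module ℂ V]

/-- A complex reflection: an invertible `g` with `dim (1 - g)V = 1`. -/
def IsComplexReflection (g : V ≃ₗ[ℂ] V) : Prop :=
  Module.finrank ℂ (LinearMap.range (LinearMap.id - (g : V →ₗ[ℂ] V))) = 1

variable (G : Subgroup (V ≃ₗ[ℂ] V))

/-- The tautological representation of a linear group `G ≤ GL(V)`. -/
def natRep : Representation ℂ G V :=
  (LinearEquiv.automorphismGroup.toLinearMapMonoidHom (R := ℂ) (M := V)).comp G.subtype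

/-- The set `S` of complex reflections in `G`. -/
abbrev Refl : Type _ := {s : G // IsComplexReflection (s : V ≃ₗ[ℂ] V)}

instance [Finite G] : Fintype (Refl G) := Fintype.ofFinite _

variable {G}

theorem isComplexReflection_conj (g s : V ≃ₗ[ℂ] V) (hs : IsComplexReflection s) :
    IsComplexReflection (g * s * g⁻¹) := by
  unfold IsComplexReflection at *
  have h : LinearMap.range (LinearMap.id - ((g * s * g⁻¹ : V ≃ₗ[ℂ] V) : V →ₗ[ℂ] V)) =
      (LinearMap.range (LinearMap.id - (s : V →ₗ[ℂ] V))).map (g : V →ₗ[ℂ] V) := by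
    ext x
    simp only [LinearMap.mem_range, Submodule.mem_map]
    constructor
    · rintro ⟨y, rfl⟩
      refine ⟨_, ⟨g⁻¹ y, rfl⟩, ?_⟩
      simp
    · rintro ⟨_, ⟨y, rfl⟩, rfl⟩
      refine ⟨g y, ?_⟩
      have : g⁻¹ (g y) = y := g.symm_apply_apply y
      simp [this]
  rw [h, LinearEquiv.finrank_map_eq]
  exact hs

/-- Conjugation `s ↦ g s g⁻¹` on the set of complex reflections. -/
def Refl.conj (g : G) (s : Refl G) : Refl G :=
  ⟨g * s.1 * g⁻¹, by
    rw [Subgroup.coe_mul, Subgroup.coe_mul, Subgroup.coe_inv]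
    exact isComplexReflection_conj _ _ s.2⟩

variable (G)

/-- The space `ℂ(S)^G` of conjugation-invariant functions on the set of complex reflections. -/
def ClassFun : Submodule ℂ (Refl G → ℂ) where
  carrier := {c | ∀ g s, c (Refl.conj g s) = c s}
  add_mem' := by
    intro a b ha hb g s
    simp [ha g s, hb g s]
  zero_mem' := by
    intro g s
    rfl
  smul_mem' := by
    intro k a ha g s
    simp [ha g s]

/-- A choice of roots `α_s ∈ V*` and coroots `α̌_s ∈ V` of all complex reflections of `G`:
`s(v) = v - ⟨α_s, v⟩ α̌_s`. -/
structure Roots where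
  root : Refl G → Module.Dual ℂ V
  coroot : Refl G → V
  apply_eq : ∀ s v, (s.1 : V ≃ₗ[ℂ] V) v = v - root s v • coroot s

theorem Roots.nonempty : Nonempty (Roots G) := by
  have key : ∀ s : Refl G, ∃ p : Module.Dual ℂ V × V,
      ∀ v, (s.1 : V ≃ₗ[ℂ] V) v = v - p.1 v • p.2 := by
    intro s
    obtain ⟨b, -, hb⟩ := finrank_eq_one_iff'.mp s.2
    let T : V →ₗ[ℂ] V := LinearMap.id - ((s.1 : V ≃ₗ[ℂ] V) : V →ₗ[ℂ] V)
    have hspan : ∀ v, ∃ k : ℂ, k • (b : V) = T v := fun v => by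
      obtain ⟨k, hk⟩ := hb ⟨T v, ⟨v, rfl⟩⟩
      exact ⟨k, congrArg Subtype.val hk⟩
    have hb0 : (b : V) ≠ 0 := by
      intro h0
      have h1 := s.2
      unfold IsComplexReflection at h1
      have : LinearMap.range T = ⊥ := by
        rw [LinearMap.range_eq_bot]
        ext v
        obtain ⟨k, hk⟩ := hspan v
        rw [← hk, h0]
        simp
      change Module.finrank ℂ (LinearMap.range T) = 1 at h1
      rw [this] at h1
      simp at h1
    obtain ⟨f, hf⟩ := Module.Projective.exists_dual_eq_one ℂ hb0
    refine ⟨(f ∘ₗ T, b), fun v => ?_⟩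
    obtain ⟨k, hk⟩ := hspan v
    have h2 : f (T v) = k := by
      rw [← hk]
      simp [hf]
    change _ = v - (f (T v)) • (b : V)
    rw [h2, hk]
    simp [T]
  choose p hp using key
  exact ⟨⟨fun s => (p s).1, fun s => (p s).2, hp⟩⟩

end Reflections

/-! ## The Yetter–Drinfeld module of a linear group -/

section YetterDrinfeld

variable {V : Type*} [AddCommGroup V] [Module ℂ V] {G : Subgroup (V ≃ₗ[ℂ] V)} (R : Roots G)

theorem Roots.exists_root_eq_one (s : Refl G) : ∃ v, R.root s v = 1 := by
  have h : R.root s ≠ 0 := by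
    intro h0
    have h1 := s.2
    unfold IsComplexReflection at h1
    have : LinearMap.id - ((s.1 : V ≃ₗ[ℂ] V) : V →ₗ[ℂ] V) = 0 := by
      ext v
      simp [R.apply_eq s v, h0]
    rw [this, LinearMap.range_zero, finrank_bot] at h1
    exact zero_ne_one h1
  obtain ⟨w, hw⟩ : ∃ w, R.root s w ≠ 0 := by
    by_contra! hc
    exact h (LinearMap.ext hc)
  exact ⟨(R.root s w)⁻¹ • w, by simp [hw]⟩

theorem Roots.coroot_ne_zero (s : Refl G) : R.coroot s ≠ 0 := by
  intro h0
  have h1 := s.2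
  unfold IsComplexReflection at h1
  have : LinearMap.id - ((s.1 : V ≃ₗ[ℂ] V) : V →ₗ[ℂ] V) = 0 := by
    ext v
    simp [R.apply_eq s v, h0]
  rw [this, LinearMap.range_zero, finrank_bot] at h1
  exact zero_ne_one h1

theorem Roots.exists_lam (g : G) (s : Refl G) :
    ∃ l : ℂ, (g : V ≃ₗ[ℂ] V) (R.coroot s) = l • R.coroot (Refl.conj g s) := by
  obtain ⟨v, hv⟩ := R.exists_root_eq_one s
  refine ⟨R.root (Refl.conj g s) ((g : V ≃ₗ[ℂ] V) v), ?_⟩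
  have h1 := R.apply_eq s v
  have h2 := R.apply_eq (Refl.conj g s) ((g : V ≃ₗ[ℂ] V) v)
  have h3 : ((Refl.conj g s).1 : V ≃ₗ[ℂ] V) ((g : V ≃ₗ[ℂ] V) v) =
      (g : V ≃ₗ[ℂ] V) ((s.1 : V ≃ₗ[ℂ] V) v) := by
    have : (g : V ≃ₗ[ℂ] V)⁻¹ ((g : V ≃ₗ[ℂ] V) v) = v :=
      (g : V ≃ₗ[ℂ] V).symm_apply_apply v
    simp [Refl.conj, LinearEquiv.mul_apply, this]
  rw [h3, h1, hv, one_smul, map_sub] at h2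
  exact sub_right_injective h2

/-- The scalar `λ(g, s)` with `g(α̌_s) = λ(g, s) α̌_{gsg⁻¹}`. -/
def Roots.lam (g : G) (s : Refl G) : ℂ := (R.exists_lam g s).choose

theorem Roots.lam_spec (g : G) (s : Refl G) :
    (g : V ≃ₗ[ℂ] V) (R.coroot s) = R.lam g s • R.coroot (Refl.conj g s) :=
  (R.exists_lam g s).choose_spec

variable (G) in
/-- The space `Y_G` with basis the symbols `[s]`, `s ∈ S`. -/
abbrev Y : Type _ := Refl G →₀ ℂ

/-- The basis vector `[s]` of `Y_G`. -/
def br (s : Refl G) : Y G := Finsupp.single s 1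

variable (G) in
/-- The vector `[s]*` of the dual basis of `Y_G*`. -/
def brDual (s : Refl G) : Module.Dual ℂ (Y G) := Finsupp.lapply s

/-- The `G`-action on `Y_G`: `g([s]) = λ(g, s)[gsg⁻¹]`. -/
def Roots.rep : Representation ℂ G (Y G) where
  toFun g := Finsupp.linearCombination ℂ fun s => R.lam g s • br (Refl.conj g s)
  map_one' := by
    ext s : 2
    have hc : Refl.conj (1 : G) s = s := Subtype.ext (by simp [Refl.conj])
    have h := R.lam_spec 1 s
    have hl : R.lam 1 s = 1 := by
      rw [hc] at h
      have h' : ((1 : ℂ) - R.lam 1 s) • R.coroot s = 0 := by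
        rw [sub_smul, ← h]
        simp
      rcases smul_eq_zero.mp h' with h' | h'
      · exact (sub_eq_zero.mp h').symm
      · exact absurd h' (R.coroot_ne_zero s)
    simp [hc, hl, br]
  map_mul' g h := by
    ext s : 2
    have hc : Refl.conj (g * h) s = Refl.conj g (Refl.conj h s) :=
      Subtype.ext (by simp [Refl.conj, mul_assoc])
    have e := R.lam_spec (g * h) s
    have hl : R.lam (g * h) s = R.lam h s * R.lam g (Refl.conj h s) := by
      have e' : ((g * h : G) : V ≃ₗ[ℂ] V) (R.coroot s) =
          (R.lam h s * R.lam g (Refl.conj h s)) • R.coroot (Refl.conj g (Refl.conj h s)) := by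
        rw [Subgroup.coe_mul, LinearEquiv.mul_apply, R.lam_spec h s, map_smul, R.lam_spec g,
          smul_smul]
      rw [e', hc] at e
      have h' := sub_eq_zero.mpr e
      rw [← sub_smul] at h'
      rcases smul_eq_zero.mp h' with h' | h'
      · exact (sub_eq_zero.mp h').symm
      · exact absurd h' (R.coroot_ne_zero _)
    simp [hc, hl, br]

/-- The braiding `Ψ([r] ⊗ [s]) = r([s]) ⊗ [r]` on `Y_G`. -/
def Roots.braiding : Y G ⊗[ℂ] Y G →ₗ[ℂ] Y G ⊗[ℂ] Y G :=
  TensorProduct.lift <| Finsupp.linearCombination ℂ fun r : Refl G =>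
    ((TensorProduct.mk ℂ (Y G) (Y G)).flip (br r)) ∘ₗ R.rep r.1

/-- The quadratic relations `ker(id + Ψ) ∩ ∧²Y_G`. -/
def Roots.quadRel : Submodule ℂ (Y G ⊗[ℂ] Y G) :=
  LinearMap.ker (LinearMap.id + R.braiding) ⊓ wedge (Y G)

/-- The quadratic relations `ker(id + Ψ*) ∩ ∧²Y_G*`. Here `Ψ*` is the adjoint of `Ψ` with respect
to `⟨f ⊗ g, v ⊗ w⟩ = ⟨f, v⟩⟨g, w⟩`, so `x` is in the kernel of `id + Ψ*` if and only if it
pairs to zero with `u + Ψ(u)` for all `u`. -/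
def Roots.quadRelDual : Submodule ℂ (Module.Dual ℂ (Y G) ⊗[ℂ] Module.Dual ℂ (Y G)) :=
  LinearMap.ker ((LinearMap.id + R.braiding).dualMap ∘ₗ TensorProduct.dualDistrib ℂ (Y G) (Y G)) ⊓
    wedge (Module.Dual ℂ (Y G))

variable (G) [Finite G]

/-- The bilinear pairing `Y_G* × Y_G → ℂG` with `([s]*, [s]) ↦ s + t` and
`([r]*, [s]) ↦ 0` for `r ≠ s`. -/
def pairingY (t : ℂ) : Module.Dual ℂ (Y G) →ₗ[ℂ] Y G →ₗ[ℂ] MonoidAlgebra ℂ G :=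
  ∑ s : Refl G, LinearMap.mk₂ ℂ
    (fun f y => (f (br s) * brDual G s y) • (MonoidAlgebra.of ℂ G s.1 + t • 1))
    (by intros; simp only [LinearMap.add_apply, add_mul, add_smul])
    (by intros; simp only [LinearMap.smul_apply, smul_eq_mul, smul_smul, mul_assoc])
    (by intros; simp only [map_add, mul_add, add_smul])
    (by intros; simp only [map_smul, smul_eq_mul, smul_smul]; congr 1; ring)

variable {G}

/-- The deformed quadratic braided double `H_t(Y_G)`. -/
abbrev Roots.DeformedDouble (t : ℂ) : Type _ :=
  Double R.rep (pairingY G t) R.quadRel R.quadRelDual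

/-- The canonical map `Y_G ⊕ ℂG ⊕ Y_G* → H_t(Y_G)`. -/
def Roots.deformedι (t : ℂ) : Gens G (Y G) →ₗ[ℂ] R.DeformedDouble t :=
  Double.ι R.rep (pairingY G t) R.quadRel R.quadRelDual

/-- The linear map `M_c : V ⊕ ℂG ⊕ V* → Y_G ⊕ ℂG ⊕ Y_G*`. -/
def Roots.M (c : Refl G → ℂ) : Gens G V →ₗ[ℂ] Gens G (Y G) :=
  LinearMap.prodMap (∑ s : Refl G, c s • (R.root s).smulRight (br s))
    (LinearMap.prodMap LinearMap.id
      (∑ s : Refl G, (Module.Dual.eval ℂ V (R.coroot s)).smulRight (brDual G s)))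

end YetterDrinfeld

/-! ## Rational Cherednik algebras -/

section Cherednik

variable {V : Type*} [AddCommGroup V] [Module ℂ V] (G : Subgroup (V ≃ₗ[ℂ] V)) [Finite G]

/-- The pairing `(f, v) ↦ t⟨f, v⟩ · 1 + ∑_s c_s ⟨f, (1 - s)v⟩ · s`. -/
def pairingV (t : ℂ) (c : Refl G → ℂ) : Module.Dual ℂ V →ₗ[ℂ] V →ₗ[ℂ] MonoidAlgebra ℂ G :=
  LinearMap.mk₂ ℂ (fun f v => (t * f v) • (1 : MonoidAlgebra ℂ G))
    (by intros; simp [mul_add, add_smul])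
    (by intros; simp only [LinearMap.smul_apply, smul_eq_mul, smul_smul]; congr 1; ring)
    (by intros; simp [mul_add, add_smul])
    (by intros; simp only [map_smul, smul_eq_mul, smul_smul]; congr 1; ring) +
  ∑ s : Refl G, LinearMap.mk₂ ℂ
    (fun f v => (c s * f (v - (s.1 : V ≃ₗ[ℂ] V) v)) • MonoidAlgebra.of ℂ G s.1)
    (by intros; simp only [LinearMap.add_apply, mul_add, add_smul])
    (by intros; simp only [LinearMap.smul_apply, smul_eq_mul, smul_smul]; congr 1; ring)
    (by intros; simp only [map_add, map_sub, ← add_smul]; congr 1; ring)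
    (by intros; simp only [map_smul, map_sub, smul_eq_mul, smul_smul]; congr 1; ring)

/-- The rational Cherednik algebra `H_{t,c}(G)`: the quadratic relations `∧²V`, `∧²V*` say that
elements of `V` commute and elements of `V*` commute. -/
abbrev Cherednik (t : ℂ) (c : Refl G → ℂ) : Type _ :=
  Double (natRep G) (pairingV G t c) (wedge V) (wedge (Module.Dual ℂ V))

/-- The canonical map `V ⊕ ℂG ⊕ V* → H_{t,c}(G)`. -/
def cherednikι (t : ℂ) (c : Refl G → ℂ) : Gens G V →ₗ[ℂ] Cherednik G t c :=
  Double.ι (natRep G) (pairingV G t c) (wedge V) (wedge (Module.Dual ℂ V))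

end Cherednik

end CherednikEmbedding

end

/-! Write `ofV` for `V → Y_G` and `toV` for `Y_G → V`, `[s] ↦ α̌_s`; on generators, `M_c` is `ofV`
on `V` and the transpose of `toV` on `V*`. The composite `toV ∘ ofV` is `∑ c_s (1 - s)`. It commutes
with `G`, so by Schur's lemma it is a scalar, and its trace identifies the scalar as `κ(c) = (dim
V)⁻¹ ∑ c_s ⟨α_s, α̌_s⟩`. At `c = 1` the real part is positive, because `1 - ⟨α_s, α̌_s⟩` is a root
of unity other than `1`; so `κ ≠ 0`.

`M_c` respects the relations. In the commutators, the terms `t' · 1` add up to `t' κ(c) ⟨f, v⟩`,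
which forces `t' = t / κ(c)`. On the images of `V` and of `V*` the braidings `Ψ` and `Ψ*` differ
from the flip by a term symmetric in the two arguments, so skew tensors go to the quadratic
relations (`map_ofV_mem_quadRel`, `map_toV_mem_quadRelDual`).

Injectivity needs no basis theorem for either algebra. The Cherednik algebra is spanned by products
`p g q` with `p` a polynomial in `V`, `g ∈ G`, `q` a polynomial in `V*` (`exists_eq_sum_triple`).
The deformed double acts on `A ⊗ Fun(G)`, where `A` is the quadratic algebra of `Y_G`: `Y_G`
multiplies, `G` acts diagonally, and `Y_G*` acts by braided derivatives whose value on `1 ⊗ w` is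
prescribed by a point `ξ ∈ Y_G` (`stdAct`). The vector `1 ⊗ δ_1` is then a joint eigenvector of
`Y_G*` with character `ξ`, and every `η ∈ Y_G*` is a character of `A`. Hence the coefficient of `p g
q` at `(η, h)` is `p(η) q(ξ)` if `g = h` and `0` otherwise. When `κ(c) ≠ 0`, suitable `η` and `ξ`
induce arbitrary points of `V*` and `V`, and these coefficients separate all combinations of the `p
g q`. -/

open scoped TensorProduct

noncomputable section

namespace CherednikEmbedding

/-! ### Skew-symmetric tensors and quadratic maps -/

section General

variable {M N A B : Type*} [AddCommGroup M] [Module ℂ M] [AddCommGroup N] [Module ℂ N]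
  [Ring A] [Algebra ℂ A] [Ring B] [Algebra ℂ B]

/-- Symmetric bilinear maps vanish on skew-symmetric tensors. -/
theorem apply_eq_zero_of_mem_wedge {N : Type*} [AddCommMonoid N] [Module ℂ N]
    (b : M ⊗[ℂ] M →ₗ[ℂ] N)
    (hb : ∀ x y, b (x ⊗ₜ y) = b (y ⊗ₜ x)) {p : M ⊗[ℂ] M} (hp : p ∈ wedge M) : b p = 0 := by
  have h1 : b ∘ₗ (TensorProduct.comm ℂ M M).toLinearMap = b :=
    TensorProduct.ext' fun x y => by simp [hb x y]
  have h2 : p + TensorProduct.comm ℂ M M p = 0 := hp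
  have h3 : b p + b p = 0 := by
    conv_lhs => rw [← h1]
    nth_rewrite 1 [h1]
    rw [LinearMap.comp_apply, LinearEquiv.coe_coe, ← map_add, h2, map_zero]
  rw [← two_smul ℂ] at h3
  have h4 := congrArg (fun x => (2⁻¹ : ℂ) • x) h3
  simpa [smul_smul] using h4

theorem map_mem_wedge (φ : M →ₗ[ℂ] N) {p : M ⊗[ℂ] M} (hp : p ∈ wedge M) :
    TensorProduct.map φ φ p ∈ wedge N := by
  have h := apply_eq_zero_of_mem_wedge
    ((LinearMap.id + (TensorProduct.comm ℂ N N).toLinearMap) ∘ₗ TensorProduct.map φ φ)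
    (fun x y => by simp [add_comm]) hp
  exact h

theorem sub_mem_wedge (x y : M) : x ⊗ₜ[ℂ] y - y ⊗ₜ[ℂ] x ∈ wedge M := by
  change x ⊗ₜ[ℂ] y - y ⊗ₜ[ℂ] x + TensorProduct.comm ℂ M M (x ⊗ₜ[ℂ] y - y ⊗ₜ[ℂ] x) = 0
  simp

@[simp] theorem quad_tmul (j : M →ₗ[ℂ] A) (x y : M) : quad j (x ⊗ₜ y) = j x * j y := rfl

theorem map_quad (φ : A →ₐ[ℂ] B) (j : M →ₗ[ℂ] A) (x : M ⊗[ℂ] M) :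
    φ (quad j x) = quad (φ.toLinearMap ∘ₗ j) x := by
  have : φ.toLinearMap ∘ₗ quad j = quad (φ.toLinearMap ∘ₗ j) :=
    TensorProduct.ext' fun x y => by simp
  exact LinearMap.congr_fun this x

theorem quad_comp (j : N →ₗ[ℂ] A) (φ : M →ₗ[ℂ] N) (x : M ⊗[ℂ] M) :
    quad (j ∘ₗ φ) x = quad j (TensorProduct.map φ φ x) := by
  have : quad (j ∘ₗ φ) = quad j ∘ₗ TensorProduct.map φ φ :=
    TensorProduct.ext' fun x y => by simp
  exact LinearMap.congr_fun this x

end General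

/-! ### Universal property of a double -/

section Double

variable {G : Type*} [Group G] {V : Type*} [AddCommGroup V] [Module ℂ V]
  (ρ : Representation ℂ G V) (β : Module.Dual ℂ V →ₗ[ℂ] V →ₗ[ℂ] MonoidAlgebra ℂ G)
  (Rm : Submodule ℂ (V ⊗[ℂ] V)) (Rp : Submodule ℂ (Module.Dual ℂ V ⊗[ℂ] Module.Dual ℂ V))
  {B : Type*} [Ring B] [Algebra ℂ B]

/-- The image of `V` in the double. -/
def Double.iV : V →ₗ[ℂ] Double ρ β Rm Rp := (RingQuot.mkAlgHom ℂ _).toLinearMap ∘ₗ genV G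

/-- The image of `V*` in the double. -/
def Double.iD : Module.Dual ℂ V →ₗ[ℂ] Double ρ β Rm Rp :=
  (RingQuot.mkAlgHom ℂ _).toLinearMap ∘ₗ genD G

/-- The image of the group algebra in the double. -/
def Double.iG : MonoidAlgebra ℂ G →ₐ[ℂ] Double ρ β Rm Rp :=
  AlgHom.ofLinearMap ((RingQuot.mkAlgHom ℂ _).toLinearMap ∘ₗ genG V)
    ((RingQuot.mkAlgHom_rel ℂ (DoubleRel.one (ρ := ρ))).trans (map_one _))
    (fun a b => (RingQuot.mkAlgHom_rel ℂ (DoubleRel.mul (ρ := ρ) a b)).trans (map_mul _ _ _))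

theorem Double.ι_apply (x : Gens G V) : Double.ι ρ β Rm Rp x =
    Double.iV ρ β Rm Rp x.1 + (Double.iG ρ β Rm Rp x.2.1 + Double.iD ρ β Rm Rp x.2.2) := by
  obtain ⟨v, a, f⟩ := x
  have h : ((v, a, f) : Gens G V) = (v, 0, 0) + ((0, a, 0) + (0, 0, f)) := by simp
  conv_lhs => rw [h, map_add, map_add]
  rfl

variable {ρ β Rm Rp}

theorem Double.iG_mul_iV (g : G) (v : V) :
    Double.iG ρ β Rm Rp (MonoidAlgebra.of ℂ G g) * Double.iV ρ β Rm Rp v =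
      Double.iV ρ β Rm Rp (ρ g v) * Double.iG ρ β Rm Rp (MonoidAlgebra.of ℂ G g) :=
  ((map_mul _ _ _).symm.trans
    (RingQuot.mkAlgHom_rel ℂ (DoubleRel.actV g v))).trans (map_mul _ _ _)

theorem Double.iG_mul_iD (g : G) (f : Module.Dual ℂ V) :
    Double.iG ρ β Rm Rp (MonoidAlgebra.of ℂ G g) * Double.iD ρ β Rm Rp f =
      Double.iD ρ β Rm Rp (ρ.dual g f) * Double.iG ρ β Rm Rp (MonoidAlgebra.of ℂ G g) :=
  ((map_mul _ _ _).symm.trans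
    (RingQuot.mkAlgHom_rel ℂ (DoubleRel.actD g f))).trans (map_mul _ _ _)

theorem Double.comm (f : Module.Dual ℂ V) (v : V) :
    Double.iD ρ β Rm Rp f * Double.iV ρ β Rm Rp v -
      Double.iV ρ β Rm Rp v * Double.iD ρ β Rm Rp f = Double.iG ρ β Rm Rp (β f v) := by
  have h := RingQuot.mkAlgHom_rel ℂ (DoubleRel.comm (ρ := ρ) (β := β) (Rm := Rm) (Rp := Rp) f v)
  rw [map_sub, map_mul, map_mul] at h
  exact h

theorem Double.quadV {x : V ⊗[ℂ] V} (hx : x ∈ Rm) : quad (Double.iV ρ β Rm Rp) x = 0 := by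
  have h := RingQuot.mkAlgHom_rel ℂ (DoubleRel.quadV (ρ := ρ) (β := β) (Rm := Rm) (Rp := Rp) x hx)
  rw [map_quad, map_zero] at h
  exact h

theorem Double.quadD {x : Module.Dual ℂ V ⊗[ℂ] Module.Dual ℂ V} (hx : x ∈ Rp) :
    quad (Double.iD ρ β Rm Rp) x = 0 := by
  have h := RingQuot.mkAlgHom_rel ℂ (DoubleRel.quadD (ρ := ρ) (β := β) (Rm := Rm) (Rp := Rp) x hx)
  rw [map_quad, map_zero] at h
  exact h

variable (ρ β Rm Rp) in
/-- The data of an algebra homomorphism from a double to `B`. -/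
structure Double.Hom (B : Type*) [Ring B] [Algebra ℂ B] where
  jV : V →ₗ[ℂ] B
  jG : MonoidAlgebra ℂ G →ₐ[ℂ] B
  jD : Module.Dual ℂ V →ₗ[ℂ] B
  actV : ∀ g v, jG (MonoidAlgebra.of ℂ G g) * jV v = jV (ρ g v) * jG (MonoidAlgebra.of ℂ G g)
  actD : ∀ g f, jG (MonoidAlgebra.of ℂ G g) * jD f =
    jD (ρ.dual g f) * jG (MonoidAlgebra.of ℂ G g)
  comm : ∀ f v, jD f * jV v - jV v * jD f = jG (β f v)
  quadV : ∀ x ∈ Rm, quad jV x = 0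
  quadD : ∀ x ∈ Rp, quad jD x = 0

/-- The universal property of a double. -/
def Double.Hom.lift (j : Double.Hom ρ β Rm Rp B) : Double ρ β Rm Rp →ₐ[ℂ] B :=
  RingQuot.liftAlgHom ℂ ⟨TensorAlgebra.lift ℂ (j.jV.coprod (j.jG.toLinearMap.coprod j.jD)), by
    have hV : ∀ v, TensorAlgebra.lift ℂ (j.jV.coprod (j.jG.toLinearMap.coprod j.jD)) (genV G v) =
      j.jV v := fun v => by simp [genV]
    have hG : ∀ v, TensorAlgebra.lift ℂ (j.jV.coprod (j.jG.toLinearMap.coprod j.jD)) (genG V v) =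
      j.jG v := fun v => by simp [genG]
    have hD : ∀ v, TensorAlgebra.lift ℂ (j.jV.coprod (j.jG.toLinearMap.coprod j.jD)) (genD G v) =
      j.jD v := fun v => by simp [genD]
    rintro _ _ (_ | ⟨a, b⟩ | ⟨g, v⟩ | ⟨g, f⟩ | ⟨f, v⟩ | ⟨x, hx⟩ | ⟨x, hx⟩)
    · rw [hG, map_one, map_one]
    · rw [hG, map_mul, map_mul, hG, hG]
    · rw [map_mul, map_mul, hG, hV, hV, j.actV]
    · rw [map_mul, map_mul, hG, hD, hD, j.actD]
    · rw [map_sub, map_mul, map_mul, hG, hD, hV, j.comm]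
    · rw [map_quad, map_zero, ← j.quadV x hx]
      congr 1
      exact congrArg _ (LinearMap.ext hV)
    · rw [map_quad, map_zero, ← j.quadD x hx]
      congr 1
      exact congrArg _ (LinearMap.ext hD)⟩

variable (j : Double.Hom ρ β Rm Rp B)

@[simp] theorem Double.Hom.lift_iV (v : V) : j.lift (Double.iV ρ β Rm Rp v) = j.jV v := by
  simp [Double.Hom.lift, Double.iV, genV]

@[simp] theorem Double.Hom.lift_iG (a : MonoidAlgebra ℂ G) :
    j.lift (Double.iG ρ β Rm Rp a) = j.jG a := by
  simp [Double.Hom.lift, Double.iG, genG]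

@[simp] theorem Double.Hom.lift_iD (f : Module.Dual ℂ V) :
    j.lift (Double.iD ρ β Rm Rp f) = j.jD f := by
  simp [Double.Hom.lift, Double.iD, genD]

/-- A subalgebra of a double containing the generators is everything. -/
theorem Double.mem_subalgebra (S : Subalgebra ℂ (Double ρ β Rm Rp))
    (hV : ∀ v, Double.iV ρ β Rm Rp v ∈ S)
    (hG : ∀ g, Double.iG ρ β Rm Rp (MonoidAlgebra.of ℂ G g) ∈ S)
    (hD : ∀ f, Double.iD ρ β Rm Rp f ∈ S) (x : Double ρ β Rm Rp) : x ∈ S := by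
  obtain ⟨x, rfl⟩ := RingQuot.mkAlgHom_surjective ℂ _ x
  induction x using TensorAlgebra.induction with
  | algebraMap r => rw [AlgHom.commutes]; exact S.algebraMap_mem r
  | ι x =>
    change Double.ι ρ β Rm Rp x ∈ S
    rw [Double.ι_apply]
    refine S.add_mem (hV _) (S.add_mem ?_ (hD _))
    induction x.2.1 using MonoidAlgebra.induction_on with
    | of g => exact hG g
    | add a b ha hb => rw [map_add]; exact S.add_mem ha hb
    | smul r a ha => rw [map_smul]; exact S.smul_mem ha r
  | mul a b ha hb => rw [map_mul]; exact S.mul_mem ha hb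
  | add a b ha hb => rw [map_add]; exact S.add_mem ha hb

end Double

/-! ### Equivariance of `M_c` and the homomorphism it defines -/

section Equivariance

variable {V : Type*} [AddCommGroup V] [Module ℂ V] {G : Subgroup (V ≃ₗ[ℂ] V)} (R : Roots G)

@[simp] theorem natRep_apply (g : G) (v : V) : natRep G g v = (g : V ≃ₗ[ℂ] V) v := rfl

theorem natRep_refl (s : Refl G) (v : V) :
    natRep G s.1 v = v - R.root s v • R.coroot s := R.apply_eq s v

@[simp] theorem Roots.rep_br (g : G) (s : Refl G) :
    R.rep g (br s) = R.lam g s • br (Refl.conj g s) := by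
  simp [Roots.rep, br]

@[simp] theorem Roots.braiding_br_tmul (r : Refl G) (z : Y G) :
    R.braiding (br r ⊗ₜ z) = R.rep r.1 z ⊗ₜ br r := by
  simp [Roots.braiding, br]

theorem Roots.mem_quadRel {x : Y G ⊗[ℂ] Y G} :
    x ∈ R.quadRel ↔ x + R.braiding x = 0 ∧ x ∈ wedge (Y G) := Iff.rfl

/-- The linear map `Y_G → V`, `[s] ↦ α̌_s`. -/
def Roots.toV : Y G →ₗ[ℂ] V := Finsupp.linearCombination ℂ R.coroot

@[simp] theorem Roots.toV_br (s : Refl G) : R.toV (br s) = R.coroot s := by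
  simp [Roots.toV, br]

theorem Y.hom_ext {N : Type*} [AddCommMonoid N] [Module ℂ N] {φ ψ : Y G →ₗ[ℂ] N}
    (h : ∀ s, φ (br s) = ψ (br s)) : φ = ψ := by
  ext s
  exact h s

theorem Roots.toV_rep (g : G) (y : Y G) : R.toV (R.rep g y) = natRep G g (R.toV y) := by
  have : R.toV ∘ₗ R.rep g = natRep G g ∘ₗ R.toV :=
    Y.hom_ext fun s => by simp [R.lam_spec g s]
  exact LinearMap.congr_fun this y

theorem natRep_conj (g : G) (s : Refl G) (v : V) :
    natRep G (Refl.conj g s).1 (natRep G g v) = natRep G g (natRep G s.1 v) := by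
  rw [← Module.End.mul_apply, ← Module.End.mul_apply, ← map_mul, ← map_mul]
  simp [Refl.conj]

/-- Applying `gsg⁻¹` to `g v` in two ways and cancelling a non-zero coroot gives the rule. Roots
pick up the same scalar as the symbols `[s]`, which is what makes `ofV` equivariant. -/
theorem Roots.root_conj (g : G) (s : Refl G) (v : V) :
    R.root (Refl.conj g s) (natRep G g v) = R.lam g s * R.root s v := by
  have h := natRep_conj g s v
  rw [natRep_refl R, natRep_refl R, map_sub, map_smul, natRep_apply g (R.coroot s),
    R.lam_spec, smul_smul] at h
  have h' := sub_right_injective h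
  rw [← sub_eq_zero, ← sub_smul] at h'
  rw [sub_eq_zero.mp ((smul_eq_zero.mp h').resolve_right (R.coroot_ne_zero _)), mul_comm]

theorem Refl.conj_mul (g h : G) (s : Refl G) :
    Refl.conj (g * h) s = Refl.conj g (Refl.conj h s) :=
  Subtype.ext (by simp [Refl.conj, mul_assoc])

theorem Refl.conj_one (s : Refl G) : Refl.conj (1 : G) s = s :=
  Subtype.ext (by simp [Refl.conj])

/-- Conjugation by `g` as a permutation of the set of reflections. -/
def Refl.conjEquiv (g : G) : Refl G ≃ Refl G where
  toFun := Refl.conj g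
  invFun := Refl.conj g⁻¹
  left_inv s := by rw [← Refl.conj_mul, inv_mul_cancel, Refl.conj_one]
  right_inv s := by rw [← Refl.conj_mul, mul_inv_cancel, Refl.conj_one]

theorem Roots.toV_dualMap_rep (g : G) (f : Module.Dual ℂ V) :
    R.toV.dualMap ((natRep G).dual g f) = R.rep.dual g (R.toV.dualMap f) := by
  refine LinearMap.ext fun y => ?_
  change f (natRep G g⁻¹ (R.toV y)) = f (R.toV (R.rep g⁻¹ y))
  rw [R.toV_rep]

/-- Only the first factor is reduced to a basis vector, since `Ψ([s] ⊗ z) = s(z) ⊗ [s]` needs no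
coordinates of `z`. -/
theorem tmul_ext_br {N : Type*} [AddCommMonoid N] [Module ℂ N] {φ ψ : Y G ⊗[ℂ] Y G →ₗ[ℂ] N}
    (h : ∀ s z, φ (br s ⊗ₜ z) = ψ (br s ⊗ₜ z)) : φ = ψ := by
  refine TensorProduct.ext (Y.hom_ext fun s => LinearMap.ext fun z => h s z)

variable [Finite G]

/-- The linear map `V → Y_G`, `v ↦ ∑_s c_s⟨α_s, v⟩[s]`. -/
def Roots.ofV (c : Refl G → ℂ) : V →ₗ[ℂ] Y G :=
  ∑ s : Refl G, c s • (R.root s).smulRight (br s)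

theorem Roots.ofV_apply (c : Refl G → ℂ) (v : V) :
    R.ofV c v = ∑ s : Refl G, (c s * R.root s v) • br s := by
  simp [Roots.ofV, LinearMap.sum_apply, mul_smul]

theorem Roots.toV_ofV (c : Refl G → ℂ) (v : V) :
    R.toV (R.ofV c v) = ∑ s : Refl G, c s • (v - natRep G s.1 v) := by
  rw [R.ofV_apply, map_sum]
  refine Finset.sum_congr rfl fun s _ => ?_
  rw [natRep_refl R, map_smul, R.toV_br, sub_sub_cancel, mul_smul]

theorem Roots.ofV_rep (c : ClassFun G) (g : G) (v : V) :
    R.ofV c (natRep G g v) = R.rep g (R.ofV c v) := by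
  rw [R.ofV_apply, R.ofV_apply, map_sum, ← Equiv.sum_comp (Refl.conjEquiv g)]
  refine Finset.sum_congr rfl fun s _ => ?_
  change ((c : Refl G → ℂ) (Refl.conj g s) * R.root (Refl.conj g s) _) • br (Refl.conj g s) = _
  rw [c.2 g s, R.root_conj, map_smul, R.rep_br, smul_smul]
  ring_nf

/-- The map `f ↦ ∑_s ⟨f, α̌_s⟩[s]*` is dual to `[s] ↦ α̌_s`. -/
theorem Roots.toV_dualMap (f : Module.Dual ℂ V) :
    R.toV.dualMap f = ∑ s : Refl G, f (R.coroot s) • brDual G s := by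
  classical
  refine Y.hom_ext fun s => ?_
  simp [brDual, LinearMap.sum_apply, br, Finsupp.single_apply, Roots.toV]

theorem Roots.M_apply (c : Refl G → ℂ) (v : V) (a : MonoidAlgebra ℂ G) (f : Module.Dual ℂ V) :
    R.M c (v, a, f) = (R.ofV c v, a, R.toV.dualMap f) := by
  simp [Roots.M, R.toV_dualMap, Roots.ofV, LinearMap.sum_apply]

theorem pairingY_br (t : ℂ) (f : Module.Dual ℂ (Y G)) (s : Refl G) :
    pairingY G t f (br s) = f (br s) • (MonoidAlgebra.of ℂ G s.1 + t • 1) := by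
  classical
  simp only [pairingY, LinearMap.sum_apply, LinearMap.mk₂_apply]
  rw [Finset.sum_eq_single s]
  · simp [brDual, br]
  · intro r _ hr
    simp [brDual, br, Ne.symm hr]
  · simp

theorem pairingV_apply (t : ℂ) (c : Refl G → ℂ) (f : Module.Dual ℂ V) (v : V) :
    pairingV G t c f v = (t * f v) • (1 : MonoidAlgebra ℂ G) +
      ∑ s : Refl G, (c s * f (v - natRep G s.1 v)) • MonoidAlgebra.of ℂ G s.1 := by
  simp [pairingV, LinearMap.sum_apply]

/-- The commutator pairings are compatible. -/
theorem Roots.pairingY_toV_ofV (c : Refl G → ℂ) {t t' k : ℂ}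
    (hk : ∀ v, R.toV (R.ofV c v) = k • v) (ht : t = t' * k) (f : Module.Dual ℂ V) (v : V) :
    pairingY G t' (R.toV.dualMap f) (R.ofV c v) = pairingV G t c f v := by
  -- The scalar part `t' · 1` of each commutator contributes one summand here; together they make up
  -- `t' k ⟨f, v⟩`.
  have h1 : t * f v = ∑ s : Refl G, t' * (c s * f (v - natRep G s.1 v)) := by
    rw [ht, ← Finset.mul_sum, mul_assoc, ← smul_eq_mul k, ← map_smul, ← hk, R.toV_ofV, map_sum]
    simp
  rw [pairingV_apply, h1, Finset.sum_smul, ← Finset.sum_add_distrib, R.ofV_apply, map_sum]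
  refine Finset.sum_congr rfl fun s _ => ?_
  have h2 : f (v - natRep G s.1 v) = R.root s v * f (R.coroot s) := by
    rw [natRep_refl R]; simp
  rw [map_smul, pairingY_br, h2, LinearMap.dualMap_apply, R.toV_br, smul_add, smul_add,
    smul_smul, smul_smul, smul_smul, add_comm]
  ring_nf

/-- `V → Y_G` maps `∧²V` to the quadratic relations. -/
theorem Roots.map_ofV_mem_quadRel (c : ClassFun G) {p : V ⊗[ℂ] V} (hp : p ∈ wedge V) :
    TensorProduct.map (R.ofV c) (R.ofV c) p ∈ R.quadRel := by
  refine R.mem_quadRel.mpr ⟨?_, map_mem_wedge _ hp⟩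
  -- On the image of `V`, the braiding is the flip minus a correction symmetric in `x` and `y`,
  -- because `s(y) = y - ⟨α_s, y⟩ α̌_s`. Hence `id + Ψ` composed with `ofV ⊗ ofV` is symmetric and
  -- kills skew tensors.
  have key : ∀ x y : V, R.braiding (R.ofV c x ⊗ₜ R.ofV c y) +
      ∑ s : Refl G, ((c : Refl G → ℂ) s * (R.root s x * R.root s y)) •
        R.ofV c (R.coroot s) ⊗ₜ[ℂ] br s = R.ofV c y ⊗ₜ[ℂ] R.ofV c x := by
    intro x y
    conv_lhs => enter [1]; rw [R.ofV_apply _ x]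
    conv_rhs => rw [R.ofV_apply _ x]
    rw [TensorProduct.sum_tmul, map_sum, TensorProduct.tmul_sum, ← Finset.sum_add_distrib]
    refine Finset.sum_congr rfl fun s _ => ?_
    rw [← TensorProduct.smul_tmul', map_smul, R.braiding_br_tmul, ← R.ofV_rep, natRep_refl R,
      TensorProduct.tmul_smul, TensorProduct.smul_tmul', TensorProduct.smul_tmul',
      TensorProduct.smul_tmul', ← TensorProduct.add_tmul]
    congr 1
    rw [map_sub, map_smul]
    module
  have aux : ∀ {a b a' b' u : Y G ⊗[ℂ] Y G}, a + u = b → a' + u = b' → b' + a = b + a' := by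
    rintro a _ a' _ u rfl rfl
    abel
  exact apply_eq_zero_of_mem_wedge
    (TensorProduct.map (R.ofV c) (R.ofV c) +
      R.braiding ∘ₗ TensorProduct.map (R.ofV c) (R.ofV c)) (fun x y => by
      change R.ofV c x ⊗ₜ[ℂ] R.ofV c y + R.braiding (R.ofV c x ⊗ₜ R.ofV c y) =
        R.ofV c y ⊗ₜ[ℂ] R.ofV c x + R.braiding (R.ofV c y ⊗ₜ R.ofV c x)
      have h := key y x
      simp only [mul_comm (R.root _ y)] at h
      exact aux (key x y) h) hp

/-- `V* → Y_G*` maps `∧²V*` to the dual quadratic relations. -/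
theorem Roots.map_toV_mem_quadRelDual {p : Module.Dual ℂ V ⊗[ℂ] Module.Dual ℂ V}
    (hp : p ∈ wedge (Module.Dual ℂ V)) :
    TensorProduct.map R.toV.dualMap R.toV.dualMap p ∈ R.quadRelDual := by
  refine ⟨?_, map_mem_wedge _ hp⟩
  refine apply_eq_zero_of_mem_wedge (((LinearMap.id + R.braiding).dualMap ∘ₗ
    TensorProduct.dualDistrib ℂ (Y G) (Y G)) ∘ₗ
      TensorProduct.map R.toV.dualMap R.toV.dualMap) (fun f g => tmul_ext_br fun s z => ?_) hp
  -- Pairing with `[s] ⊗ z + s(z) ⊗ [s]` leaves `f(α̌_s) g(z) + f(z) g(α̌_s) - ⟨α_s, z⟩ f(α̌_s)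
  -- g(α̌_s)` (with `z` read in `V`), symmetric in `f` and `g`.
  simp [TensorProduct.dualDistrib_apply, R.toV_rep, natRep_refl R, -natRep_apply]
  ring

/-- The homomorphism `H_{t,c}(G) → H_{t'}(Y_G)` given by `M_c`. -/
def Roots.embedding (c : ClassFun G) {t t' k : ℂ} (hk : ∀ v, R.toV (R.ofV c v) = k • v)
    (ht : t = t' * k) : Cherednik G t c →ₐ[ℂ] R.DeformedDouble t' :=
  Double.Hom.lift
    { jV := Double.iV _ _ _ _ ∘ₗ R.ofV c
      jG := Double.iG _ _ _ _
      jD := Double.iD _ _ _ _ ∘ₗ R.toV.dualMap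
      actV := fun g v => by
        rw [LinearMap.comp_apply, LinearMap.comp_apply, R.ofV_rep, Double.iG_mul_iV]
      actD := fun g f => by
        rw [LinearMap.comp_apply, LinearMap.comp_apply, R.toV_dualMap_rep, Double.iG_mul_iD]
      comm := fun f v => by
        rw [LinearMap.comp_apply, LinearMap.comp_apply, Double.comm,
          R.pairingY_toV_ofV c hk ht]
      quadV := fun x hx => by
        rw [quad_comp, Double.quadV (R.map_ofV_mem_quadRel c hx)]
      quadD := fun x hx => by
        rw [quad_comp, Double.quadD (R.map_toV_mem_quadRelDual hx)] }

theorem Roots.embedding_ι (c : ClassFun G) {t t' k : ℂ} (hk : ∀ v, R.toV (R.ofV c v) = k • v)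
    (ht : t = t' * k) (x : Gens G V) :
    R.embedding c hk ht (cherednikι G t c x) = R.deformedι t' (R.M c x) := by
  obtain ⟨v, a, f⟩ := x
  rw [R.M_apply, cherednikι, Roots.deformedι, Double.ι_apply, Double.ι_apply]
  simp [Roots.embedding]

end Equivariance

/-! ### The functional `κ`: Schur's lemma, trace and non-vanishing -/

section Kappa

variable {V : Type*} [AddCommGroup V] [Module ℂ V] [FiniteDimensional ℂ V]
  {G : Subgroup (V ≃ₗ[ℂ] V)} [Finite G] (R : Roots G)

theorem Roots.exists_toV_ofV_eq_smul (hirr : (natRep G).IsIrreducible) (c : ClassFun G) :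
    ∃ k : ℂ, ∀ v, R.toV (R.ofV c v) = k • v := by
  let T : Representation.IntertwiningMap (natRep G) (natRep G) :=
    ⟨R.toV ∘ₗ R.ofV c, fun g => LinearMap.ext fun v => by
      rw [LinearMap.comp_apply, LinearMap.comp_apply, LinearMap.comp_apply, LinearMap.comp_apply,
        R.ofV_rep, R.toV_rep]⟩
  obtain ⟨k, hk⟩ :=
    (Representation.IsIrreducible.algebraMap_intertwiningMap_bijective_of_isAlgClosed
      (ρ := natRep G)).2 T
  refine ⟨k, fun v => ?_⟩
  change T v = k • v
  rw [← hk, Algebra.algebraMap_eq_smul_one]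
  rfl

theorem Roots.trace_toV_ofV (c : Refl G → ℂ) :
    LinearMap.trace ℂ V (R.toV ∘ₗ R.ofV c) =
      ∑ s : Refl G, c s * R.root s (R.coroot s) := by
  have : R.toV ∘ₗ R.ofV c = ∑ s : Refl G, c s • (R.root s).smulRight (R.coroot s) := by
    ext v
    simp [Roots.ofV, LinearMap.sum_apply]
  rw [this, map_sum]
  simp [LinearMap.trace_smulRight]

/-- The functional `κ`. -/
def Roots.kappa : ClassFun G →ₗ[ℂ] ℂ :=
  (Module.finrank ℂ V : ℂ)⁻¹ •
    (∑ s : Refl G, R.root s (R.coroot s) • LinearMap.proj s) ∘ₗ (ClassFun G).subtype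

theorem Roots.kappa_apply (c : ClassFun G) : R.kappa c =
    (Module.finrank ℂ V : ℂ)⁻¹ * ∑ s : Refl G, (c : Refl G → ℂ) s * R.root s (R.coroot s) := by
  simp [Roots.kappa, mul_comm]

theorem finrank_ne_zero_of_isIrreducible (hirr : (natRep G).IsIrreducible) :
    (Module.finrank ℂ V : ℂ) ≠ 0 := by
  have : Nontrivial V := by
    by_contra h
    rw [not_nontrivial_iff_subsingleton] at h
    have h2 := hirr.toNontrivial
    obtain ⟨a, b, hab⟩ := h2
    exact hab (SetLike.ext fun x => by
      rw [Subsingleton.elim x 0]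
      exact iff_of_true a.toSubmodule.zero_mem b.toSubmodule.zero_mem)
  exact_mod_cast Module.finrank_pos.ne'

theorem Roots.toV_ofV_eq_kappa_smul (hirr : (natRep G).IsIrreducible) (c : ClassFun G) (v : V) :
    R.toV (R.ofV c v) = R.kappa c • v := by
  obtain ⟨k, hk⟩ := R.exists_toV_ofV_eq_smul hirr c
  have h : R.toV ∘ₗ R.ofV c = k • LinearMap.id := LinearMap.ext hk
  have h1 := R.trace_toV_ofV c
  rw [h, map_smul, LinearMap.trace_id, smul_eq_mul] at h1
  rw [hk, R.kappa_apply, ← h1]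
  congr 1
  field_simp [finrank_ne_zero_of_isIrreducible hirr]

/-- The coroot is an eigenvector of `s` with eigenvalue `1 - a`, a root of unity as `s` has finite
order. It is not `1`, since otherwise `s` would be a transvection, of infinite order; so its real
part is less than `1`. -/
theorem Roots.re_root_coroot_pos (s : Refl G) : 0 < (R.root s (R.coroot s)).re := by
  set a := R.root s (R.coroot s) with ha
  have hn : 0 < orderOf s.1 := orderOf_pos s.1
  have hpow : ∀ n : ℕ, natRep G (s.1 ^ n) (R.coroot s) = (1 - a) ^ n • R.coroot s := by
    intro n
    induction n with
    | zero => simp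
    | succ n ih =>
      rw [pow_succ', map_mul, Module.End.mul_apply, ih, map_smul, natRep_refl R, ← ha,
        pow_succ, mul_smul, sub_smul, one_smul]
  have h1 : (1 - a) ^ orderOf s.1 = 1 := by
    have h := hpow (orderOf s.1)
    rw [pow_orderOf_eq_one, map_one, Module.End.one_apply, ← sub_eq_zero] at h
    have h' : (1 - (1 - a) ^ orderOf s.1) • R.coroot s = 0 := by rw [sub_smul, one_smul, h]
    exact (sub_eq_zero.mp ((smul_eq_zero.mp h').resolve_right (R.coroot_ne_zero s))).symm
  have hnorm : ‖1 - a‖ = 1 := Complex.norm_eq_one_of_pow_eq_one h1 hn.ne'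
  have hne : a ≠ 0 := by
    intro h0
    obtain ⟨v, hv⟩ := R.exists_root_eq_one s
    have hv' : ∀ n : ℕ, natRep G (s.1 ^ n) v = v - (n : ℂ) • R.coroot s := by
      intro n
      induction n with
      | zero => simp
      | succ n ih =>
        rw [pow_succ', map_mul, Module.End.mul_apply, ih, map_sub, map_smul, natRep_refl R,
          natRep_refl R, ← ha, h0, hv]
        push_cast
        module
    have h := hv' (orderOf s.1)
    rw [pow_orderOf_eq_one, map_one, Module.End.one_apply, eq_comm, sub_eq_self] at h
    rcases smul_eq_zero.mp h with h | h
    · exact hn.ne' (by exact_mod_cast h)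
    · exact R.coroot_ne_zero s h
  have h2 : (1 - a.re) ^ 2 + a.im ^ 2 = 1 := by
    have := Complex.sq_norm (1 - a)
    rw [hnorm, Complex.normSq_apply] at this
    simp at this
    linarith
  -- The circle `|1 - a| = 1` meets the half-plane `Re a ≤ 0` only at `a = 0`.
  by_contra! hle
  have him : a.im = 0 := by nlinarith [sq_nonneg a.im, sq_nonneg a.re]
  have hre : a.re = 0 := by nlinarith [sq_nonneg a.im, sq_nonneg a.re]
  exact hne (Complex.ext hre him)

theorem Roots.kappa_ne_zero [Nonempty (Refl G)] (hirr : (natRep G).IsIrreducible) :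
    R.kappa ≠ 0 := by
  intro h0
  have h := LinearMap.congr_fun h0 (⟨fun _ => 1, fun _ _ => rfl⟩ : ClassFun G)
  rw [R.kappa_apply, LinearMap.zero_apply] at h
  have h1 := (mul_eq_zero.mp h).resolve_left
    (inv_ne_zero (finrank_ne_zero_of_isIrreducible hirr))
  have h2 := congrArg Complex.re h1
  simp only [one_mul, Complex.re_sum, Complex.zero_re] at h2
  exact (Finset.sum_pos (fun s _ => R.re_root_coroot_pos s) Finset.univ_nonempty).ne' h2

end Kappa

/-! ### The quadratic algebra of `Y_G`, its `G`-action and its characters -/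

section QuadraticAlgebra

variable {V : Type*} [AddCommGroup V] [Module ℂ V] {G : Subgroup (V ≃ₗ[ℂ] V)} (R : Roots G)

/-- The defining relations of the quadratic algebra of `Y_G`. -/
inductive Roots.QuadAlgRel : TensorAlgebra ℂ (Y G) → TensorAlgebra ℂ (Y G) → Prop
  | quad (x : Y G ⊗[ℂ] Y G) (hx : x ∈ R.quadRel) :
      Roots.QuadAlgRel (quad (TensorAlgebra.ι ℂ) x) 0

/-- The quadratic algebra `T(Y_G) / (ker(id + Ψ) ∩ ∧²Y_G)`. -/
def Roots.QuadAlg : Type _ := RingQuot R.QuadAlgRel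

instance : Ring R.QuadAlg := inferInstanceAs (Ring (RingQuot R.QuadAlgRel))

instance : Algebra ℂ R.QuadAlg := inferInstanceAs (Algebra ℂ (RingQuot R.QuadAlgRel))

/-- The projection from the tensor algebra to the quadratic algebra. -/
def Roots.mkQuadAlg : TensorAlgebra ℂ (Y G) →ₐ[ℂ] R.QuadAlg := RingQuot.mkAlgHom ℂ R.QuadAlgRel

theorem Roots.mkQuadAlg_surjective : Function.Surjective R.mkQuadAlg :=
  RingQuot.mkAlgHom_surjective ℂ _

/-- The inclusion of generators in the quadratic algebra. -/
def Roots.iY : Y G →ₗ[ℂ] R.QuadAlg :=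
  R.mkQuadAlg.toLinearMap ∘ₗ TensorAlgebra.ι ℂ

theorem Roots.quad_iY {x : Y G ⊗[ℂ] Y G} (hx : x ∈ R.quadRel) : quad R.iY x = 0 := by
  have h : R.mkQuadAlg _ = R.mkQuadAlg 0 :=
    RingQuot.mkAlgHom_rel ℂ (Roots.QuadAlgRel.quad (R := R) x hx)
  rw [map_quad, map_zero] at h
  exact h

variable {R} in
/-- The universal property of the quadratic algebra. -/
def Roots.QuadAlg.lift {B : Type*} [Ring B] [Algebra ℂ B] (j : Y G →ₗ[ℂ] B)
    (hj : ∀ x ∈ R.quadRel, quad j x = 0) : R.QuadAlg →ₐ[ℂ] B :=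
  RingQuot.liftAlgHom ℂ ⟨TensorAlgebra.lift ℂ j, by
    rintro _ _ ⟨x, hx⟩
    rw [map_quad, map_zero, ← hj x hx]
    congr 1
    exact congrArg _ (LinearMap.ext fun y => TensorAlgebra.lift_ι_apply _ _)⟩

variable {R} in
@[simp] theorem Roots.QuadAlg.lift_iY {B : Type*} [Ring B] [Algebra ℂ B] (j : Y G →ₗ[ℂ] B)
    (hj : ∀ x ∈ R.quadRel, quad j x = 0) (y : Y G) :
    Roots.QuadAlg.lift j hj (R.iY y) = j y :=
  (RingQuot.liftAlgHom_mkAlgHom_apply ..).trans (TensorAlgebra.lift_ι_apply _ _)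

variable {R} in
-- Induction on words in the `[s]`. It is stated for linear maps because it is applied to
-- derivatives, which are not multiplicative.
theorem Roots.QuadAlg.hom_ext {N : Type*} [AddCommGroup N] [Module ℂ N]
    {φ ψ : R.QuadAlg →ₗ[ℂ] N} (h1 : φ 1 = ψ 1)
    (hmul : ∀ s a, φ a = ψ a → φ (R.iY (br s) * a) = ψ (R.iY (br s) * a)) : φ = ψ := by
  have key : ∀ x : TensorAlgebra ℂ (Y G), ∀ a, φ a = ψ a →
      φ (R.mkQuadAlg x * a) = ψ (R.mkQuadAlg x * a) := by
    intro x
    induction x using TensorAlgebra.induction with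
    | algebraMap r =>
      intro a ha
      rw [AlgHom.commutes, ← Algebra.smul_def, map_smul, map_smul, ha]
    | ι y =>
      intro a ha
      have : φ ∘ₗ LinearMap.mulRight ℂ a ∘ₗ R.iY = ψ ∘ₗ LinearMap.mulRight ℂ a ∘ₗ R.iY :=
        Y.hom_ext fun s => hmul s a ha
      exact LinearMap.congr_fun this y
    | mul x y hx hy =>
      intro a ha
      rw [map_mul (R.mkQuadAlg), mul_assoc]
      exact hx _ (hy _ ha)
    | add x y hx hy =>
      intro a ha
      rw [map_add, add_mul, map_add, map_add, hx a ha, hy a ha]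
  refine LinearMap.ext fun a => ?_
  obtain ⟨x, rfl⟩ := R.mkQuadAlg_surjective a
  simpa using key x 1 h1

/-- The braiding commutes with the diagonal action, since `(gsg⁻¹) g = g s` and the scalar `λ(g, s)`
appears on both sides. -/
theorem Roots.map_rep_mem_quadRel (g : G) {x : Y G ⊗[ℂ] Y G} (hx : x ∈ R.quadRel) :
    TensorProduct.map (R.rep g) (R.rep g) x ∈ R.quadRel := by
  have h : R.braiding ∘ₗ TensorProduct.map (R.rep g) (R.rep g) =
      TensorProduct.map (R.rep g) (R.rep g) ∘ₗ R.braiding := by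
    refine tmul_ext_br (G := G) fun s z => ?_
    have : (Refl.conj g s).1 * g = g * s.1 := by simp [Refl.conj]
    rw [LinearMap.comp_apply, LinearMap.comp_apply, TensorProduct.map_tmul, R.rep_br,
      ← TensorProduct.smul_tmul', map_smul, R.braiding_br_tmul, R.braiding_br_tmul,
      TensorProduct.map_tmul, R.rep_br, TensorProduct.tmul_smul, ← Module.End.mul_apply,
      ← Module.End.mul_apply, ← map_mul, ← map_mul, this]
  have h' := LinearMap.congr_fun h x
  rw [LinearMap.comp_apply, LinearMap.comp_apply] at h'
  refine R.mem_quadRel.mpr ⟨?_, map_mem_wedge (R.rep g) (R.mem_quadRel.mp hx).2⟩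
  rw [h', ← map_add, (R.mem_quadRel.mp hx).1, map_zero]

/-- The action of `G` on the quadratic algebra. -/
def Roots.act (g : G) : R.QuadAlg →ₐ[ℂ] R.QuadAlg :=
  Roots.QuadAlg.lift (R.iY ∘ₗ R.rep g) fun x hx => by
    rw [quad_comp, R.quad_iY (R.map_rep_mem_quadRel g hx)]

@[simp] theorem Roots.act_iY (g : G) (y : Y G) : R.act g (R.iY y) = R.iY (R.rep g y) := by
  simp [Roots.act]

theorem Roots.act_one (a : R.QuadAlg) : R.act 1 a = a := by
  have : (R.act 1).toLinearMap = LinearMap.id :=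
    Roots.QuadAlg.hom_ext (by simp) fun s a ha => by
      simp only [AlgHom.toLinearMap_apply, LinearMap.id_apply] at ha ⊢
      rw [map_mul, ha, R.act_iY, map_one, Module.End.one_apply]
  exact LinearMap.congr_fun this a

theorem Roots.act_mul (g h : G) (a : R.QuadAlg) : R.act (g * h) a = R.act g (R.act h a) := by
  have : (R.act (g * h)).toLinearMap = (R.act g).toLinearMap ∘ₗ (R.act h).toLinearMap :=
    Roots.QuadAlg.hom_ext (by simp) fun s a ha => by
      simp only [AlgHom.toLinearMap_apply, LinearMap.comp_apply] at ha ⊢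
      rw [map_mul, ha, R.act_iY, map_mul, map_mul, map_mul, R.act_iY, R.act_iY,
        Module.End.mul_apply]
  exact LinearMap.congr_fun this a

/-- Evaluation of the quadratic algebra at a point of `Y_G*`. -/
def Roots.evalAt (η : Module.Dual ℂ (Y G)) : R.QuadAlg →ₐ[ℂ] ℂ :=
  Roots.QuadAlg.lift η fun _ hx =>
    apply_eq_zero_of_mem_wedge _ (fun x y => by simp [mul_comm]) hx.2

@[simp] theorem Roots.evalAt_iY (η : Module.Dual ℂ (Y G)) (y : Y G) :
    R.evalAt η (R.iY y) = η y := by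
  simp [Roots.evalAt]

end QuadraticAlgebra

/-! ### The module `A ⊗ Fun(G)` with its actions of `Y_G` and `G` -/

section StandardModule

variable {V : Type*} [AddCommGroup V] [Module ℂ V] {G : Subgroup (V ≃ₗ[ℂ] V)} (R : Roots G)

/-- The induced module on which a double acts. -/
def Roots.Std : Type _ := R.QuadAlg ⊗[ℂ] (G → ℂ)

instance : AddCommGroup R.Std := inferInstanceAs (AddCommGroup (R.QuadAlg ⊗[ℂ] (G → ℂ)))

instance : Module ℂ R.Std := inferInstanceAs (Module ℂ (R.QuadAlg ⊗[ℂ] (G → ℂ)))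

/-- The pure tensor `a ⊗ w` in the standard module. -/
def Roots.tm : R.QuadAlg →ₗ[ℂ] (G → ℂ) →ₗ[ℂ] R.Std := TensorProduct.mk ℂ R.QuadAlg (G → ℂ)

variable {R} in
theorem Roots.Std.ext {N : Type*} [AddCommGroup N] [Module ℂ N] {φ ψ : R.Std →ₗ[ℂ] N}
    (h : ∀ a w, φ (R.tm a w) = ψ (R.tm a w)) : φ = ψ :=
  TensorProduct.ext' (M := R.QuadAlg) (N := G → ℂ) h

variable {R} in
/-- Linear maps out of the standard module. -/
def Roots.Std.lift {N : Type*} [AddCommGroup N] [Module ℂ N]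
    (b : R.QuadAlg →ₗ[ℂ] (G → ℂ) →ₗ[ℂ] N) : R.Std →ₗ[ℂ] N :=
  TensorProduct.lift b

variable {R} in
@[simp] theorem Roots.Std.lift_tm {N : Type*} [AddCommGroup N] [Module ℂ N]
    (b : R.QuadAlg →ₗ[ℂ] (G → ℂ) →ₗ[ℂ] N) (a : R.QuadAlg) (w : G → ℂ) :
    Roots.Std.lift b (R.tm a w) = b a w := rfl

variable {R} in
theorem Roots.Std.hom_ext {N : Type*} [AddCommGroup N] [Module ℂ N] {φ ψ : R.Std →ₗ[ℂ] N}
    (h1 : ∀ w, φ (R.tm 1 w) = ψ (R.tm 1 w))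
    (hmul : ∀ s a w, φ (R.tm a w) = ψ (R.tm a w) →
      φ (R.tm (R.iY (br s) * a) w) = ψ (R.tm (R.iY (br s) * a) w)) : φ = ψ := by
  refine Roots.Std.ext fun a w => ?_
  have : φ ∘ₗ R.tm.flip w = ψ ∘ₗ R.tm.flip w :=
    Roots.QuadAlg.hom_ext (h1 w) fun s a ha => hmul s a w ha
  exact LinearMap.congr_fun this a

/-- Left multiplication on the standard module. -/
def Roots.mulStd : R.QuadAlg →ₐ[ℂ] Module.End ℂ R.Std :=
  AlgHom.ofLinearMap
    { toFun := fun a => Roots.Std.lift (R.tm ∘ₗ LinearMap.mulLeft ℂ a)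
      map_add' := fun a b => Roots.Std.ext fun _ _ => by simp [add_mul]
      map_smul' := fun c a => Roots.Std.ext fun _ _ => by simp }
    (Roots.Std.ext fun _ _ => by simp)
    (fun a b => Roots.Std.ext fun _ _ => by simp)

@[simp] theorem Roots.mulStd_tm (a b : R.QuadAlg) (w : G → ℂ) :
    R.mulStd a (R.tm b w) = R.tm (a * b) w := rfl

/-- The action of `Y_G` on the standard module. -/
def Roots.stdY : Y G →ₗ[ℂ] Module.End ℂ R.Std := R.mulStd.toLinearMap ∘ₗ R.iY

@[simp] theorem Roots.stdY_tm (y : Y G) (b : R.QuadAlg) (w : G → ℂ) :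
    R.stdY y (R.tm b w) = R.tm (R.iY y * b) w := rfl

theorem Roots.quad_stdY {x : Y G ⊗[ℂ] Y G} (hx : x ∈ R.quadRel) : quad R.stdY x = 0 := by
  rw [Roots.stdY, ← map_quad, R.quad_iY hx, map_zero]

/-- Translation of functions on `G`. -/
def translate (g : G) : (G → ℂ) →ₗ[ℂ] (G → ℂ) := LinearMap.funLeft ℂ ℂ (g⁻¹ * ·)

theorem translate_apply (g : G) (w : G → ℂ) (h : G) : translate g w h = w (g⁻¹ * h) := rfl

/-- The diagonal action of `G` on the standard module. -/
def Roots.stdG : G →* Module.End ℂ R.Std where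
  toFun g := Roots.Std.lift (R.tm.compl₁₂ (R.act g).toLinearMap (translate g))
  map_one' := Roots.Std.ext fun a w => by
    have : translate (1 : G) w = w := funext fun h => by simp [translate_apply]
    simp [R.act_one, this]
  map_mul' g h := Roots.Std.ext fun a w => by
    have : translate (g * h) w = translate g (translate h w) :=
      funext fun k => by simp [translate_apply, mul_assoc]
    simp [R.act_mul, this]

@[simp] theorem Roots.stdG_tm (g : G) (a : R.QuadAlg) (w : G → ℂ) :
    R.stdG g (R.tm a w) = R.tm (R.act g a) (translate g w) := rfl

/-- The action of the group algebra on the standard module. -/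
def Roots.stdGAlg : MonoidAlgebra ℂ G →ₐ[ℂ] Module.End ℂ R.Std :=
  MonoidAlgebra.lift ℂ _ G R.stdG

@[simp] theorem Roots.stdGAlg_of (g : G) : R.stdGAlg (MonoidAlgebra.of ℂ G g) = R.stdG g := by
  simp [Roots.stdGAlg]

theorem Roots.stdG_mul_stdY (g : G) (y : Y G) :
    R.stdG g * R.stdY y = R.stdY (R.rep g y) * R.stdG g :=
  Roots.Std.ext fun a w => by simp

end StandardModule

/-! ### Derivations as corners of triangular matrices -/

section Triangular

variable {M N : Type*} [AddCommGroup M] [Module ℂ M] [AddCommGroup N] [Module ℂ N]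

/-- The block triangular operators with diagonal blocks `a m` and upper block `b m`. -/
def triangularMap (a b : M →ₗ[ℂ] Module.End ℂ N) : M →ₗ[ℂ] Module.End ℂ (N × N) where
  toFun m := (a m ∘ₗ LinearMap.fst ℂ N N + b m ∘ₗ LinearMap.snd ℂ N N).prod
    (a m ∘ₗ LinearMap.snd ℂ N N)
  map_add' x y := LinearMap.ext fun z => Prod.ext (by simp [add_add_add_comm]) (by simp)
  map_smul' c y := LinearMap.ext fun z => Prod.ext (by simp) (by simp)

theorem triangularMap_apply (a b : M →ₗ[ℂ] Module.End ℂ N) (m : M) (x : N × N) :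
    triangularMap a b m x = (a m x.1 + b m x.2, a m x.2) := rfl

/-- The map `u ⊗ w ↦ a(u) b(w) + b(u) a(w)`. -/
def leibnizMap (a b : M →ₗ[ℂ] Module.End ℂ N) : M ⊗[ℂ] M →ₗ[ℂ] Module.End ℂ N :=
  TensorProduct.lift ((LinearMap.mul ℂ (Module.End ℂ N)).compl₁₂ a b +
    (LinearMap.mul ℂ (Module.End ℂ N)).compl₁₂ b a)

@[simp] theorem leibnizMap_tmul (a b : M →ₗ[ℂ] Module.End ℂ N) (u w : M) :
    leibnizMap a b (u ⊗ₜ w) = a u * b w + b u * a w := rfl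

theorem quad_triangularMap (a b : M →ₗ[ℂ] Module.End ℂ N) (q : M ⊗[ℂ] M) (x : N × N) :
    quad (triangularMap a b) q x = (quad a q x.1 + leibnizMap a b q x.2, quad a q x.2) := by
  induction q using TensorProduct.induction_on with
  | zero =>
    simp only [map_zero, LinearMap.zero_apply, add_zero]
    rfl
  | tmul u w =>
    simp only [quad_tmul, Module.End.mul_apply, triangularMap_apply, leibnizMap_tmul, map_add,
      LinearMap.add_apply, add_assoc]
  | add p q hp hq =>
    rw [map_add, LinearMap.add_apply, hp, hq, Prod.mk_add_mk]
    simp only [map_add, LinearMap.add_apply, add_add_add_comm]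

/-- The upper corner of a product of triangular operators obeys a Leibniz rule. This lets a braided
derivative be defined on a quotient of the tensor algebra by checking the quadratic relations alone.
-/
theorem quad_triangularMap_eq_zero (a b : M →ₗ[ℂ] Module.End ℂ N) {q : M ⊗[ℂ] M}
    (ha : quad a q = 0) (hb : leibnizMap a b q = 0) : quad (triangularMap a b) q = 0 := by
  refine LinearMap.ext fun x => ?_
  rw [quad_triangularMap, ha, hb]
  simp only [LinearMap.zero_apply, add_zero]
  rfl

end Triangular

/-! ### Braided derivatives: the action of `Y_G*` and of the whole deformed double -/

section DualAction

variable {V : Type*} [AddCommGroup V] [Module ℂ V] {G : Subgroup (V ≃ₗ[ℂ] V)} (R : Roots G)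

/-- The action of `Y_G*` on functions on `G` determined by a point `ξ` of `Y_G`. -/
def Roots.charAct (ξ : Y G) : Module.Dual ℂ (Y G) →ₗ[ℂ] Module.End ℂ (G → ℂ) :=
  LinearMap.mk₂ ℂ (fun f w h => f (R.rep h ξ) * w h)
    (by intros; ext; simp [add_mul])
    (by intros; ext; simp [mul_assoc])
    (by intros; ext; simp [mul_add])
    (by intros; ext; simp [mul_left_comm])

@[simp] theorem Roots.charAct_apply (ξ : Y G) (f : Module.Dual ℂ (Y G)) (w : G → ℂ) (h : G) :
    R.charAct ξ f w h = f (R.rep h ξ) * w h := rfl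

theorem Roots.translate_charAct (ξ : Y G) (g : G) (f : Module.Dual ℂ (Y G)) (w : G → ℂ) :
    translate g (R.charAct ξ f w) = R.charAct ξ (R.rep.dual g f) (translate g w) := by
  ext h
  simp only [translate_apply, charAct_apply, Representation.dual_apply, Module.Dual.transpose_apply,
    LinearMap.comp_apply]
  rw [map_mul, Module.End.mul_apply]

theorem Roots.quad_charAct (ξ : Y G) {p : Module.Dual ℂ (Y G) ⊗[ℂ] Module.Dual ℂ (Y G)}
    (hp : p ∈ R.quadRelDual) : quad (R.charAct ξ) p = 0 :=
  apply_eq_zero_of_mem_wedge _ (fun f g => by ext; simp [mul_left_comm]) hp.2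

variable [Finite G] (t : ℂ)

/-- The commutator of `Y_G*` and `Y_G` on the standard module. -/
def Roots.stdPairing : Module.Dual ℂ (Y G) →ₗ[ℂ] Y G →ₗ[ℂ] Module.End ℂ R.Std :=
  (pairingY G t).compr₂ R.stdGAlg.toLinearMap

theorem Roots.stdPairing_apply (f : Module.Dual ℂ (Y G)) (y : Y G) :
    R.stdPairing t f y = R.stdGAlg (pairingY G t f y) := rfl

theorem Roots.stdPairing_br (f : Module.Dual ℂ (Y G)) (s : Refl G) :
    R.stdPairing t f (br s) = f (br s) • (R.stdG s.1 + t • 1) := by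
  rw [R.stdPairing_apply, pairingY_br, map_smul, map_add, map_smul, map_one, R.stdGAlg_of]

/-- On `y = [s]` both sides carry the coefficient `⟨f, [s]⟩ = ⟨g f, g [s]⟩`, and `g` conjugates `s`
to `gsg⁻¹`. -/
theorem Roots.stdG_mul_stdPairing (g : G) (f : Module.Dual ℂ (Y G)) (y : Y G) :
    R.stdG g * R.stdPairing t f y = R.stdPairing t (R.rep.dual g f) (R.rep g y) * R.stdG g := by
  have : LinearMap.mulLeft ℂ (R.stdG g) ∘ₗ R.stdPairing t f =
      LinearMap.mulRight ℂ (R.stdG g) ∘ₗ R.stdPairing t (R.rep.dual g f) ∘ₗ R.rep g := by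
    refine Y.hom_ext fun s => ?_
    have h1 : R.rep.dual g f (R.rep g (br s)) = f (br s) := by
      rw [Representation.dual_apply, Module.Dual.transpose_apply, LinearMap.comp_apply,
        ← Module.End.mul_apply, ← map_mul, inv_mul_cancel, map_one, Module.End.one_apply]
    have h2 : (Refl.conj g s).1 * g = g * s.1 := by simp [Refl.conj]
    rw [R.rep_br, map_smul, smul_eq_mul] at h1
    simp only [LinearMap.comp_apply, LinearMap.mulLeft_apply, LinearMap.mulRight_apply, R.rep_br,
      map_smul, R.stdPairing_br, smul_smul, h1, mul_smul_comm, smul_mul_assoc, mul_add, add_mul,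
      ← map_mul, h2, mul_one, one_mul]
  exact LinearMap.congr_fun this y

/-- The braided derivative along `f`, as a triangular operator. -/
def Roots.triangular (f : Module.Dual ℂ (Y G)) : Y G →ₗ[ℂ] Module.End ℂ (R.Std × R.Std) :=
  triangularMap R.stdY (R.stdPairing t f)

theorem Roots.triangular_apply (f : Module.Dual ℂ (Y G)) (y : Y G) (x : R.Std × R.Std) :
    R.triangular t f y x = (R.stdY y x.1 + R.stdPairing t f y x.2, R.stdY y x.2) := rfl

/-- The map `u ⊗ w ↦ u β(f, w) + β(f, u) w`. -/
def Roots.leibniz (f : Module.Dual ℂ (Y G)) : Y G ⊗[ℂ] Y G →ₗ[ℂ] Module.End ℂ R.Std :=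
  leibnizMap R.stdY (R.stdPairing t f)

theorem Roots.leibniz_tmul (f : Module.Dual ℂ (Y G)) (u w : Y G) :
    R.leibniz t f (u ⊗ₜ w) = R.stdY u * R.stdPairing t f w + R.stdPairing t f u * R.stdY w := rfl

theorem Roots.stdPairing_eq (f : Module.Dual ℂ (Y G)) (y : Y G) :
    R.stdPairing t f y = R.stdPairing 0 f y + (t * f y) • 1 := by
  have : R.stdPairing t f = R.stdPairing 0 f + (t • f).smulRight 1 :=
    Y.hom_ext fun s => by
      simp [R.stdPairing_br, smul_smul, mul_comm]
  simpa using LinearMap.congr_fun this y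

/-- The two conditions in the relations play separate roles. The part proportional to `t` is
symmetric in the factors and dies on `∧²`; in the rest, moving `s` past `z` turns the second Leibniz
term into the first composed with `Ψ`, so it factors through `id + Ψ`. -/
theorem Roots.leibniz_eq_zero (f : Module.Dual ℂ (Y G)) {x : Y G ⊗[ℂ] Y G}
    (hx : x ∈ R.quadRel) : R.leibniz t f x = 0 := by
  rw [R.mem_quadRel] at hx
  let T : Y G ⊗[ℂ] Y G →ₗ[ℂ] Module.End ℂ R.Std :=
    TensorProduct.lift ((LinearMap.mul ℂ _).compl₁₂ R.stdY (f.smulRight 1) +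
      (LinearMap.mul ℂ _).compl₁₂ (f.smulRight 1) R.stdY)
  let C : Y G ⊗[ℂ] Y G →ₗ[ℂ] Module.End ℂ R.Std :=
    TensorProduct.lift ((LinearMap.mul ℂ _).compl₁₂ R.stdY (R.stdPairing 0 f))
  have hT : ∀ u w, T (u ⊗ₜ w) = f w • R.stdY u + f u • R.stdY w := fun u w => by simp [T]
  have hC : ∀ u w, C (u ⊗ₜ w) = R.stdY u * R.stdPairing 0 f w := fun u w => rfl
  have key : R.leibniz t f = t • T + (C + C ∘ₗ R.braiding) := by
    refine tmul_ext_br fun s z => ?_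
    simp only [LinearMap.add_apply, LinearMap.smul_apply, LinearMap.comp_apply,
      R.braiding_br_tmul, R.leibniz_tmul, hT, hC, R.stdPairing_eq t]
    have h0 : R.stdPairing 0 f (br s) * R.stdY z =
        R.stdY (R.rep s.1 z) * R.stdPairing 0 f (br s) := by
      rw [R.stdPairing_br, zero_smul, add_zero, smul_mul_assoc, R.stdG_mul_stdY, mul_smul_comm]
    rw [mul_add, add_mul, h0]
    simp only [mul_smul_comm, smul_mul_assoc, mul_one, one_mul, smul_add, smul_smul]
    abel
  rw [key, LinearMap.add_apply, LinearMap.add_apply, LinearMap.comp_apply, ← map_add, hx.1,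
    map_zero, add_zero, LinearMap.smul_apply,
    apply_eq_zero_of_mem_wedge T (fun u w => by rw [hT, hT, add_comm]) hx.2, smul_zero]

theorem Roots.quad_triangular (f : Module.Dual ℂ (Y G)) {q : Y G ⊗[ℂ] Y G} (hq : q ∈ R.quadRel) :
    quad (R.triangular t f) q = 0 :=
  quad_triangularMap_eq_zero R.stdY (R.stdPairing t f) (R.quad_stdY hq)
    (R.leibniz_eq_zero t f hq)

/-- The action of the quadratic algebra by triangular operators. -/
def Roots.triangularAlg (f : Module.Dual ℂ (Y G)) :
    R.QuadAlg →ₐ[ℂ] Module.End ℂ (R.Std × R.Std) :=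
  Roots.QuadAlg.lift (R.triangular t f) fun _ hq => R.quad_triangular t f hq

theorem Roots.triangularAlg_iY_mul (f : Module.Dual ℂ (Y G)) (y : Y G) (a : R.QuadAlg)
    (x : R.Std × R.Std) : R.triangularAlg t f (R.iY y * a) x =
      R.triangular t f y (R.triangularAlg t f a x) := by
  rw [map_mul, Roots.triangularAlg, Roots.QuadAlg.lift_iY, Module.End.mul_apply]

theorem Roots.triangularAlg_snd (f : Module.Dual ℂ (Y G)) (a : R.QuadAlg)
    (x : R.Std × R.Std) : (R.triangularAlg t f a x).2 = R.mulStd a x.2 := by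
  have : LinearMap.snd ℂ _ _ ∘ₗ (LinearMap.applyₗ x) ∘ₗ (R.triangularAlg t f).toLinearMap =
      (LinearMap.applyₗ x.2) ∘ₗ R.mulStd.toLinearMap :=
    Roots.QuadAlg.hom_ext (by simp) fun s a ha => by
      simp only [LinearMap.comp_apply, AlgHom.toLinearMap_apply, LinearMap.applyₗ_apply_apply,
        LinearMap.snd_apply] at ha ⊢
      rw [R.triangularAlg_iY_mul, R.triangular_apply, ha, map_mul]
      rfl
  exact LinearMap.congr_fun this a

variable (ξ : Y G)

/-- The braided derivative along `f` on the standard module. -/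
def Roots.deriv (f : Module.Dual ℂ (Y G)) : Module.End ℂ R.Std :=
  Roots.Std.lift (LinearMap.mk₂ ℂ
    (fun a w => (R.triangularAlg t f a (R.tm 1 (R.charAct ξ f w), R.tm 1 w)).1)
    (by intros; simp)
    (by intros; simp)
    (by
      intro a w w'
      rw [map_add, map_add, map_add, ← Prod.mk_add_mk, map_add]
      rfl)
    (by
      intro c a w
      rw [map_smul, map_smul, map_smul, ← Prod.smul_mk, map_smul]
      rfl))

theorem Roots.deriv_tm (f : Module.Dual ℂ (Y G)) (a : R.QuadAlg) (w : G → ℂ) :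
    R.deriv t ξ f (R.tm a w) = (R.triangularAlg t f a (R.tm 1 (R.charAct ξ f w), R.tm 1 w)).1 := rfl

theorem Roots.deriv_one_tm (f : Module.Dual ℂ (Y G)) (w : G → ℂ) :
    R.deriv t ξ f (R.tm 1 w) = R.tm 1 (R.charAct ξ f w) := by
  rw [R.deriv_tm, map_one]
  rfl

/-- This is the upper row of the triangular action, the lower row being plain multiplication.
Together with the value on `1 ⊗ w` it determines the derivative, and all later identities are
deduced from these two facts. -/
theorem Roots.deriv_mul_stdY (f : Module.Dual ℂ (Y G)) (y : Y G) :
    R.deriv t ξ f * R.stdY y = R.stdY y * R.deriv t ξ f + R.stdPairing t f y :=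
  Roots.Std.ext fun a w => by
    rw [Module.End.mul_apply, R.stdY_tm, R.deriv_tm, R.triangularAlg_iY_mul,
      R.triangular_apply, R.triangularAlg_snd, R.mulStd_tm, mul_one]
    rfl

/-- Operators on the standard module commuting with `Y_G` in the same way are equal if they
agree on the degree zero part. -/
theorem Roots.Std.end_ext {P Q : Module.End ℂ R.Std} (h1 : ∀ w, P (R.tm 1 w) = Q (R.tm 1 w))
    (h : ∀ s x, P x = Q x → P (R.stdY (br s) x) = Q (R.stdY (br s) x)) : P = Q :=
  Roots.Std.hom_ext h1 fun s a w haw => h s (R.tm a w) haw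

theorem Roots.deriv_stdY (f : Module.Dual ℂ (Y G)) (y : Y G) (x : R.Std) :
    R.deriv t ξ f (R.stdY y x) = R.stdY y (R.deriv t ξ f x) + R.stdPairing t f y x :=
  LinearMap.congr_fun (R.deriv_mul_stdY t ξ f y) x

theorem Roots.stdG_stdY (g : G) (y : Y G) (x : R.Std) :
    R.stdG g (R.stdY y x) = R.stdY (R.rep g y) (R.stdG g x) :=
  LinearMap.congr_fun (R.stdG_mul_stdY g y) x

/-- The action of `Y_G*` on the standard module. -/
def Roots.stdD : Module.Dual ℂ (Y G) →ₗ[ℂ] Module.End ℂ R.Std where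
  toFun := R.deriv t ξ
  -- Linearity in `f` is not visible in the construction, where `f` enters through an algebra
  -- homomorphism; it follows because both sides have the same degree zero part and the same
  -- commutators with `Y_G`.
  map_add' f g := Roots.Std.end_ext R
    (fun w => by
      simp only [LinearMap.add_apply, R.deriv_one_tm, map_add])
    (fun s x h => by
      rw [LinearMap.add_apply] at h ⊢
      rw [R.deriv_stdY, R.deriv_stdY, R.deriv_stdY, h, map_add, map_add, LinearMap.add_apply,
        LinearMap.add_apply]
      abel)
  map_smul' c f := Roots.Std.end_ext R
    (fun w => by
      simp only [LinearMap.smul_apply, R.deriv_one_tm, map_smul,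
        RingHom.id_apply])
    (fun s x h => by
      rw [RingHom.id_apply, LinearMap.smul_apply] at h ⊢
      rw [R.deriv_stdY, R.deriv_stdY, h, map_smul, map_smul, LinearMap.smul_apply,
        LinearMap.smul_apply, smul_add])

theorem Roots.stdD_one_tm (f : Module.Dual ℂ (Y G)) (w : G → ℂ) :
    R.stdD t ξ f (R.tm 1 w) = R.tm 1 (R.charAct ξ f w) := R.deriv_one_tm t ξ f w

theorem Roots.stdD_stdY (f : Module.Dual ℂ (Y G)) (y : Y G) (x : R.Std) :
    R.stdD t ξ f (R.stdY y x) = R.stdY y (R.stdD t ξ f x) + R.stdPairing t f y x :=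
  R.deriv_stdY t ξ f y x

theorem Roots.stdG_mul_stdD (g : G) (f : Module.Dual ℂ (Y G)) :
    R.stdG g * R.stdD t ξ f = R.stdD t ξ (R.rep.dual g f) * R.stdG g := by
  refine Roots.Std.end_ext R (fun w => ?_) (fun s x h => ?_)
  · rw [Module.End.mul_apply, Module.End.mul_apply, R.stdD_one_tm, R.stdG_tm, R.stdG_tm,
      map_one, R.stdD_one_tm, R.translate_charAct]
  · rw [Module.End.mul_apply, Module.End.mul_apply] at h ⊢
    rw [R.stdD_stdY, map_add, R.stdG_stdY, R.stdG_stdY, R.stdD_stdY, h]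
    congr 1
    exact LinearMap.congr_fun (R.stdG_mul_stdPairing t g f (br s)) x

/-- The operator vanishes on `1 ⊗ w`, where `Y_G*` acts by commuting multiplications, so it suffices
that it commutes with each `[s]`. The commutator `E s p` again splits: a symmetric part with factor
`t`, killed by `∧²`, and a part `K p`, killed by `ker(id + Ψ*)`. -/
theorem Roots.quad_stdD {p : Module.Dual ℂ (Y G) ⊗[ℂ] Module.Dual ℂ (Y G)}
    (hp : p ∈ R.quadRelDual) : quad (R.stdD t ξ) p = (0 : Module.End ℂ R.Std) := by
  let E (s : Refl G) : Module.Dual ℂ (Y G) ⊗[ℂ] Module.Dual ℂ (Y G) →ₗ[ℂ] Module.End ℂ R.Std :=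
    TensorProduct.lift ((LinearMap.mul ℂ _).compl₁₂ (R.stdD t ξ) ((R.stdPairing t).flip (br s)) +
      (LinearMap.mul ℂ _).compl₁₂ ((R.stdPairing t).flip (br s)) (R.stdD t ξ))
  have hE : ∀ s f g, E s (f ⊗ₜ g) = R.stdD t ξ f * R.stdPairing t g (br s) +
      R.stdPairing t f (br s) * R.stdD t ξ g := fun _ _ _ => rfl
  have hstep : ∀ (p : Module.Dual ℂ (Y G) ⊗[ℂ] Module.Dual ℂ (Y G)) s x,
      quad (R.stdD t ξ) p (R.stdY (br s) x) =
        R.stdY (br s) (quad (R.stdD t ξ) p x) + E s p x := by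
    intro p s x
    induction p using TensorProduct.induction_on with
    | zero => simp
    | tmul f g =>
      rw [quad_tmul, Module.End.mul_apply, Module.End.mul_apply, R.stdD_stdY, map_add,
        R.stdD_stdY, hE, LinearMap.add_apply, Module.End.mul_apply, Module.End.mul_apply]
      abel
    | add a b ha hb =>
      simp only [map_add, LinearMap.add_apply, ha, hb]
      abel
  have hzero : ∀ (p : Module.Dual ℂ (Y G) ⊗[ℂ] Module.Dual ℂ (Y G)) w,
      quad (R.stdD t ξ) p (R.tm 1 w) = R.tm 1 (quad (R.charAct ξ) p w) := by
    intro p w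
    induction p using TensorProduct.induction_on with
    | zero => simp
    | tmul f g =>
      simp only [quad_tmul, Module.End.mul_apply, R.stdD_one_tm]
    | add a b ha hb =>
      simp only [map_add, LinearMap.add_apply, ha, hb]
  have hEp : ∀ s, E s p = 0 := by
    intro s
    let T : Module.Dual ℂ (Y G) ⊗[ℂ] Module.Dual ℂ (Y G) →ₗ[ℂ] Module.Dual ℂ (Y G) :=
      TensorProduct.lift ((LinearMap.lsmul ℂ _).flip.compl₁₂ LinearMap.id
        (Module.Dual.eval ℂ _ (br s)) +
        (LinearMap.lsmul ℂ _).compl₁₂ (Module.Dual.eval ℂ _ (br s)) LinearMap.id)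
    let K : Module.Dual ℂ (Y G) ⊗[ℂ] Module.Dual ℂ (Y G) →ₗ[ℂ] Module.Dual ℂ (Y G) :=
      TensorProduct.lift ((LinearMap.lsmul ℂ _).flip.compl₁₂ LinearMap.id
        (Module.Dual.eval ℂ _ (br s)) +
        (LinearMap.lsmul ℂ _).compl₁₂ (Module.Dual.eval ℂ _ (br s)) (R.rep.dual s.1))
    have hT : ∀ f g, T (f ⊗ₜ g) = g (br s) • f + f (br s) • g := fun _ _ => rfl
    have hK : ∀ f g, K (f ⊗ₜ g) = g (br s) • f + f (br s) • R.rep.dual s.1 g := fun _ _ => rfl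
    have hEs : E s = t • (R.stdD t ξ ∘ₗ T) +
        LinearMap.mulRight ℂ (R.stdG s.1) ∘ₗ R.stdD t ξ ∘ₗ K := by
      refine TensorProduct.ext' fun f g => ?_
      simp only [LinearMap.add_apply, LinearMap.smul_apply, LinearMap.comp_apply, hE, hT, hK,
        R.stdPairing_br, LinearMap.mulRight_apply, map_add, map_smul, mul_add, add_mul,
        mul_smul_comm, smul_mul_assoc, mul_one, one_mul, R.stdG_mul_stdD, smul_add, smul_smul,
        mul_comm t]
      abel
    have hTp : T p = 0 :=
      apply_eq_zero_of_mem_wedge T (fun f g => by rw [hT, hT, add_comm]) hp.2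
    have hKp : K p = 0 := by
      refine LinearMap.ext fun z => ?_
      -- The tensor paired with `q` is `(id + Ψ)([s] ⊗ s⁻¹z)`, so membership of `p` in `ker(id +
      -- Ψ*)` applies directly.
      have hKz : ∀ q, K q z = TensorProduct.dualDistrib ℂ (Y G) (Y G) q
          (br s ⊗ₜ R.rep s.1⁻¹ z + z ⊗ₜ br s) := by
        intro q
        induction q using TensorProduct.induction_on with
        | zero => simp
        | tmul f g =>
          rw [hK, map_add, TensorProduct.dualDistrib_apply, TensorProduct.dualDistrib_apply]
          simp [Representation.dual_apply, Module.Dual.transpose_apply]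
          ring
        | add a b ha hb =>
          rw [K.map_add, LinearMap.add_apply, ha, hb,
            (TensorProduct.dualDistrib ℂ (Y G) (Y G)).map_add]
          rfl
      have h1 : R.braiding (br s ⊗ₜ R.rep s.1⁻¹ z) = z ⊗ₜ br s := by
        rw [R.braiding_br_tmul, ← Module.End.mul_apply, ← map_mul, mul_inv_cancel, map_one,
          Module.End.one_apply]
      rw [hKz, ← h1]
      exact LinearMap.congr_fun hp.1 (br s ⊗ₜ R.rep s.1⁻¹ z)
    rw [hEs, LinearMap.add_apply, LinearMap.smul_apply, LinearMap.comp_apply,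
      LinearMap.comp_apply, LinearMap.comp_apply, hTp, hKp, map_zero, map_zero, smul_zero,
      add_zero]
  refine Roots.Std.end_ext R (fun w => ?_) (fun s x h => ?_)
  · rw [hzero, R.quad_charAct ξ hp]
    simp
  · rw [hstep, h, hEp]
    simp

/-- The action of the deformed double on the standard module. -/
def Roots.stdAct : R.DeformedDouble t →ₐ[ℂ] Module.End ℂ R.Std :=
  Double.Hom.lift
    { jV := R.stdY
      jG := R.stdGAlg
      jD := R.stdD t ξ
      actV := fun g v => by rw [R.stdGAlg_of, R.stdG_mul_stdY]
      actD := fun g f => by rw [R.stdGAlg_of, R.stdG_mul_stdD]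
      comm := fun f v => LinearMap.ext fun x => by
        rw [LinearMap.sub_apply, Module.End.mul_apply, Module.End.mul_apply, R.stdD_stdY,
          add_sub_cancel_left, R.stdPairing_apply]
      quadV := fun x hx => R.quad_stdY hx
      quadD := fun x hx => R.quad_stdD t ξ hx }

end DualAction

/-! ### Polynomials in commuting operators and their evaluations -/

section Commuting

variable {ι B : Type*} [Ring B] [Algebra ℂ B]

open scoped IsMulCommutative in
/-- Evaluation of polynomials at commuting elements of an algebra. -/
def aevalOfComm (x : ι → B) (h : ∀ i j, x i * x j = x j * x i) : MvPolynomial ι ℂ →ₐ[ℂ] B :=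
  haveI := Algebra.isMulCommutative_adjoin ℂ (s := Set.range x) (by
    rintro _ ⟨i, rfl⟩ _ ⟨j, rfl⟩
    exact h i j)
  (Algebra.adjoin ℂ (Set.range x)).val.comp
    (MvPolynomial.aeval fun i => ⟨x i, Algebra.subset_adjoin ⟨i, rfl⟩⟩)

@[simp] theorem aevalOfComm_X (x : ι → B) (h : ∀ i j, x i * x j = x j * x i) (i : ι) :
    aevalOfComm x h (MvPolynomial.X i) = x i := by
  simp [aevalOfComm]

theorem apply_eq_eval_smul {N : Type*} [AddCommGroup N] [Module ℂ N]
    (A : MvPolynomial ι ℂ →ₐ[ℂ] Module.End ℂ N) {μ : ι → ℂ} {v : N}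
    (h : ∀ i, A (MvPolynomial.X i) v = μ i • v) (p : MvPolynomial ι ℂ) :
    A p v = MvPolynomial.eval μ p • v := by
  induction p using MvPolynomial.induction_on with
  | C a => simp [MvPolynomial.algHom_C, Module.algebraMap_end_apply]
  | add p q hp hq => rw [map_add, LinearMap.add_apply, hp, hq, map_add, add_smul]
  | mul_X p i hp =>
    rw [map_mul, Module.End.mul_apply, h, map_smul, hp, smul_smul, map_mul, MvPolynomial.eval_X,
      mul_comm]

theorem apply_eq_eval_mul {N : Type*} [AddCommGroup N] [Module ℂ N]
    (A : MvPolynomial ι ℂ →ₐ[ℂ] Module.End ℂ N) {μ : ι → ℂ} {l : N →ₗ[ℂ] ℂ}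
    (h : ∀ i x, l (A (MvPolynomial.X i) x) = μ i * l x) (p : MvPolynomial ι ℂ) (x : N) :
    l (A p x) = MvPolynomial.eval μ p * l x := by
  induction p using MvPolynomial.induction_on generalizing x with
  | C a => simp [MvPolynomial.algHom_C, Module.algebraMap_end_apply]
  | add p q hp hq => rw [map_add, LinearMap.add_apply, map_add, hp, hq, map_add, add_mul]
  | mul_X p i hp =>
    rw [map_mul, Module.End.mul_apply, hp, h, map_mul, MvPolynomial.eval_X, mul_assoc]

/-- Evaluation of a tensor product of polynomials at a pair of points. -/
def evalPair (a b : ι → ℂ) : MvPolynomial ι ℂ ⊗[ℂ] MvPolynomial ι ℂ →ₗ[ℂ] ℂ :=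
  (MvPolynomial.aeval (Sum.elim a b)).toLinearMap ∘ₗ
    (MvPolynomial.tensorEquivSum ℂ ι ι ℂ).toLinearMap.restrictScalars ℂ

theorem evalPair_tmul (a b : ι → ℂ) (p q : MvPolynomial ι ℂ) :
    evalPair a b (p ⊗ₜ q) = MvPolynomial.eval a p * MvPolynomial.eval b q := by
  let A : MvPolynomial ι ℂ ⊗[ℂ] MvPolynomial ι ℂ →ₐ[ℂ] ℂ :=
    (MvPolynomial.aeval (Sum.elim a b)).comp
      ((MvPolynomial.tensorEquivSum ℂ ι ι ℂ).toAlgHom.restrictScalars ℂ)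
  have h : A = Algebra.TensorProduct.productMap (MvPolynomial.aeval a) (MvPolynomial.aeval b) := by
    ext i <;> simp [A]
  have := DFunLike.congr_fun h (p ⊗ₜ q)
  rwa [Algebra.TensorProduct.productMap_apply_tmul] at this

theorem eq_zero_of_evalPair_eq_zero {z : MvPolynomial ι ℂ ⊗[ℂ] MvPolynomial ι ℂ}
    (h : ∀ a b, evalPair a b z = 0) : z = 0 := by
  apply (MvPolynomial.tensorEquivSum ℂ ι ι ℂ).injective
  rw [map_zero]
  refine MvPolynomial.funext fun x => ?_
  have := h (x ∘ Sum.inl) (x ∘ Sum.inr)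
  rw [evalPair, Sum.elim_comp_inl_inr] at this
  rw [map_zero]
  exact this

end Commuting

/-! ### Normal ordering: the products `p g q` span the double -/

section Spanning

variable {G : Type*} [Group G] {V : Type*} [AddCommGroup V] [Module ℂ V]
  (ρ : Representation ℂ G V) (β : Module.Dual ℂ V →ₗ[ℂ] V →ₗ[ℂ] MonoidAlgebra ℂ G)

theorem Double.iV_comm (x y : V) :
    Double.iV ρ β (wedge V) (wedge (Module.Dual ℂ V)) x *
      Double.iV ρ β (wedge V) (wedge (Module.Dual ℂ V)) y =
    Double.iV ρ β (wedge V) (wedge (Module.Dual ℂ V)) y *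
      Double.iV ρ β (wedge V) (wedge (Module.Dual ℂ V)) x := by
  have h := Double.quadV (ρ := ρ) (β := β) (Rp := wedge (Module.Dual ℂ V)) (sub_mem_wedge x y)
  rwa [map_sub, quad_tmul, quad_tmul, sub_eq_zero] at h

theorem Double.iD_comm (x y : Module.Dual ℂ V) :
    Double.iD ρ β (wedge V) (wedge (Module.Dual ℂ V)) x *
      Double.iD ρ β (wedge V) (wedge (Module.Dual ℂ V)) y =
    Double.iD ρ β (wedge V) (wedge (Module.Dual ℂ V)) y *
      Double.iD ρ β (wedge V) (wedge (Module.Dual ℂ V)) x := by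
  have h := Double.quadD (ρ := ρ) (β := β) (Rm := wedge V) (sub_mem_wedge x y)
  rwa [map_sub, quad_tmul, quad_tmul, sub_eq_zero] at h

variable {ι : Type*} (b : Module.Basis ι ℂ V)

/-- Polynomials on `V*` in the double with commuting `V`. -/
def Double.polyV : MvPolynomial ι ℂ →ₐ[ℂ] Double ρ β (wedge V) (wedge (Module.Dual ℂ V)) :=
  aevalOfComm (fun i => Double.iV ρ β _ _ (b i)) fun i j => Double.iV_comm ρ β (b i) (b j)

/-- Polynomials on `V` in the double with commuting `V*`. -/
def Double.polyD : MvPolynomial ι ℂ →ₐ[ℂ] Double ρ β (wedge V) (wedge (Module.Dual ℂ V)) :=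
  aevalOfComm (fun i => Double.iD ρ β _ _ (b.coord i)) fun i j =>
    Double.iD_comm ρ β (b.coord i) (b.coord j)

/-- The element of the group `G` in the double. -/
def Double.grp (g : G) : Double ρ β (wedge V) (wedge (Module.Dual ℂ V)) :=
  Double.iG ρ β _ _ (MonoidAlgebra.of ℂ G g)

@[simp] theorem Double.polyV_X (i : ι) :
    Double.polyV ρ β b (MvPolynomial.X i) = Double.iV ρ β _ _ (b i) := by simp [Double.polyV]

@[simp] theorem Double.polyD_X (i : ι) :
    Double.polyD ρ β b (MvPolynomial.X i) = Double.iD ρ β _ _ (b.coord i) := by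
  simp [Double.polyD]

theorem Double.grp_mul (g h : G) :
    Double.grp ρ β (g * h) = Double.grp ρ β g * Double.grp ρ β h := by
  simp only [Double.grp, map_mul]

variable [Fintype ι]

theorem Double.exists_polyV (v : V) :
    ∃ p, Double.polyV ρ β b p = Double.iV ρ β _ _ v := by
  refine ⟨∑ i, b.repr v i • MvPolynomial.X i, ?_⟩
  conv_rhs => rw [← b.sum_repr v]
  simp only [map_sum, map_smul, Double.polyV_X]

theorem Double.exists_polyD (f : Module.Dual ℂ V) :
    ∃ p, Double.polyD ρ β b p = Double.iD ρ β _ _ f := by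
  refine ⟨∑ i, f (b i) • MvPolynomial.X i, ?_⟩
  conv_rhs => rw [← b.sum_dual_apply_smul_coord f]
  simp only [map_sum, map_smul, Double.polyD_X]

theorem Double.exists_grp_mul_polyV (g : G) (p : MvPolynomial ι ℂ) :
    ∃ p', Double.grp ρ β g * Double.polyV ρ β b p = Double.polyV ρ β b p' * Double.grp ρ β g := by
  induction p using MvPolynomial.induction_on with
  | C a =>
    refine ⟨MvPolynomial.C a, ?_⟩
    rw [MvPolynomial.algHom_C]
    exact (Algebra.commutes _ _).symm
  | add p q hp hq =>
    obtain ⟨p', hp'⟩ := hp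
    obtain ⟨q', hq'⟩ := hq
    exact ⟨p' + q', by rw [map_add, mul_add, hp', hq', map_add, add_mul]⟩
  | mul_X p i hp =>
    obtain ⟨p', hp'⟩ := hp
    obtain ⟨r, hr⟩ := Double.exists_polyV ρ β b (ρ g (b i))
    refine ⟨p' * r, ?_⟩
    rw [map_mul, ← mul_assoc, hp', mul_assoc, Double.polyV_X, Double.grp, Double.iG_mul_iV, ← hr,
      map_mul, mul_assoc]

/-- The map `p ⊗ q ↦ p g q` to the double. -/
def Double.triple (g : G) : MvPolynomial ι ℂ ⊗[ℂ] MvPolynomial ι ℂ →ₗ[ℂ]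
    Double ρ β (wedge V) (wedge (Module.Dual ℂ V)) :=
  TensorProduct.lift ((LinearMap.mul ℂ _).compl₁₂
    (LinearMap.mulRight ℂ (Double.grp ρ β g) ∘ₗ (Double.polyV ρ β b).toLinearMap)
    (Double.polyD ρ β b).toLinearMap)

@[simp] theorem Double.triple_tmul (g : G) (p q : MvPolynomial ι ℂ) :
    Double.triple ρ β b g (p ⊗ₜ q) =
      Double.polyV ρ β b p * Double.grp ρ β g * Double.polyD ρ β b q := rfl

/-- The span of the products `p g q`. -/
def Double.tripleSpan : Submodule ℂ (Double ρ β (wedge V) (wedge (Module.Dual ℂ V))) :=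
  Submodule.span ℂ {x | ∃ p g q, x =
    Double.polyV ρ β b p * Double.grp ρ β g * Double.polyD ρ β b q}

theorem Double.mul_mem_tripleSpan {y : Double ρ β (wedge V) (wedge (Module.Dual ℂ V))}
    (hy : ∀ p g q, y * (Double.polyV ρ β b p * Double.grp ρ β g * Double.polyD ρ β b q) ∈
      Double.tripleSpan ρ β b) {x} (hx : x ∈ Double.tripleSpan ρ β b) :
    y * x ∈ Double.tripleSpan ρ β b := by
  induction hx using Submodule.span_induction with
  | mem x hx =>
    obtain ⟨p, g, q, rfl⟩ := hx
    exact hy p g q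
  | zero => rw [mul_zero]; exact Submodule.zero_mem _
  | add x z _ _ hx hz => rw [mul_add]; exact Submodule.add_mem _ hx hz
  | smul a x _ hx => rw [mul_smul_comm]; exact Submodule.smul_mem _ a hx

theorem Double.polyV_mul_mem (r : MvPolynomial ι ℂ) {x} (hx : x ∈ Double.tripleSpan ρ β b) :
    Double.polyV ρ β b r * x ∈ Double.tripleSpan ρ β b :=
  Double.mul_mem_tripleSpan ρ β b (fun p g q => Submodule.subset_span
    ⟨r * p, g, q, by simp only [map_mul, mul_assoc]⟩) hx

theorem Double.iV_mul_mem (v : V) {x} (hx : x ∈ Double.tripleSpan ρ β b) :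
    Double.iV ρ β _ _ v * x ∈ Double.tripleSpan ρ β b := by
  obtain ⟨r, hr⟩ := Double.exists_polyV ρ β b v
  rw [← hr]
  exact Double.polyV_mul_mem ρ β b r hx

theorem Double.grp_mul_mem (h : G) {x} (hx : x ∈ Double.tripleSpan ρ β b) :
    Double.grp ρ β h * x ∈ Double.tripleSpan ρ β b :=
  Double.mul_mem_tripleSpan ρ β b (fun p g q => by
    obtain ⟨p', hp'⟩ := Double.exists_grp_mul_polyV ρ β b h p
    refine Submodule.subset_span ⟨p', h * g, q, ?_⟩
    rw [← mul_assoc, ← mul_assoc, hp', Double.grp_mul, mul_assoc (Double.polyV ρ β b p')]) hx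

theorem Double.iG_mul_mem (a : MonoidAlgebra ℂ G) {x} (hx : x ∈ Double.tripleSpan ρ β b) :
    Double.iG ρ β _ _ a * x ∈ Double.tripleSpan ρ β b := by
  induction a using MonoidAlgebra.induction_on with
  | of g => exact Double.grp_mul_mem ρ β b g hx
  | add a a' ha ha' => rw [map_add, add_mul]; exact Submodule.add_mem _ ha ha'
  | smul r a ha => rw [map_smul, smul_mul_assoc]; exact Submodule.smul_mem _ r ha

/-- Move `f` to the right past one linear factor at a time. Each commutator lies in `ℂG`, which
preserves the span; the factor passed is absorbed into `x`, hence the induction over all `x`. -/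
theorem Double.iD_mul_polyV_mul_mem (f : Module.Dual ℂ V) (p : MvPolynomial ι ℂ) {x}
    (hx : x ∈ Double.tripleSpan ρ β b)
    (hfx : Double.iD ρ β _ _ f * x ∈ Double.tripleSpan ρ β b) :
    Double.iD ρ β _ _ f * (Double.polyV ρ β b p * x) ∈ Double.tripleSpan ρ β b := by
  induction p using MvPolynomial.induction_on generalizing x with
  | C a =>
    rw [MvPolynomial.algHom_C, ← Algebra.smul_def, mul_smul_comm]
    exact Submodule.smul_mem _ a hfx
  | add p q hp hq =>
    rw [map_add, add_mul, mul_add]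
    exact Submodule.add_mem _ (hp hx hfx) (hq hx hfx)
  | mul_X p i hp =>
    rw [map_mul, mul_assoc, Double.polyV_X]
    refine hp (Double.iV_mul_mem ρ β b _ hx) ?_
    have h := Double.comm (ρ := ρ) (β := β) (Rm := wedge V) (Rp := wedge (Module.Dual ℂ V)) f (b i)
    rw [← mul_assoc, sub_eq_iff_eq_add.mp h, add_mul, mul_assoc]
    exact Submodule.add_mem _ (Double.iG_mul_mem ρ β b _ hx) (Double.iV_mul_mem ρ β b _ hfx)

theorem Double.iD_mul_mem (f : Module.Dual ℂ V) {x} (hx : x ∈ Double.tripleSpan ρ β b) :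
    Double.iD ρ β _ _ f * x ∈ Double.tripleSpan ρ β b := by
  refine Double.mul_mem_tripleSpan ρ β b (fun p g q => ?_) hx
  rw [mul_assoc]
  refine Double.iD_mul_polyV_mul_mem ρ β b f p
    (Submodule.subset_span ⟨1, g, q, by rw [map_one, one_mul]⟩) ?_
  -- Here `f g = g (g⁻¹ f)`, so `f` reaches the polynomials in `V*`.
  obtain ⟨r, hr⟩ := Double.exists_polyD ρ β b (ρ.dual g⁻¹ f)
  refine Submodule.subset_span ⟨1, g, r * q, ?_⟩
  have h := Double.iG_mul_iD (ρ := ρ) (β := β) (Rm := wedge V) (Rp := wedge (Module.Dual ℂ V)) g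
    (ρ.dual g⁻¹ f)
  rw [← Module.End.mul_apply, ← map_mul, mul_inv_cancel, map_one, Module.End.one_apply] at h
  rw [map_one, one_mul, map_mul, ← mul_assoc, ← mul_assoc, hr]
  exact congrArg (· * _) h.symm

/-- The elements whose left multiplication preserves the span form a subalgebra containing all
generators, hence everything; apply this to `1`. -/
theorem Double.mem_tripleSpan (x : Double ρ β (wedge V) (wedge (Module.Dual ℂ V))) :
    x ∈ Double.tripleSpan ρ β b := by
  let S : Subalgebra ℂ (Double ρ β (wedge V) (wedge (Module.Dual ℂ V))) :=
    { carrier := {y | ∀ z ∈ Double.tripleSpan ρ β b, y * z ∈ Double.tripleSpan ρ β b}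
      mul_mem' := fun {y y'} hy hy' z hz => by rw [mul_assoc]; exact hy _ (hy' z hz)
      add_mem' := fun {y y'} hy hy' z hz => by
        rw [add_mul]; exact Submodule.add_mem _ (hy z hz) (hy' z hz)
      algebraMap_mem' := fun r z hz => by
        rw [← Algebra.smul_def]; exact Submodule.smul_mem _ r hz }
  have h : x ∈ S := Double.mem_subalgebra S (fun v z hz => Double.iV_mul_mem ρ β b v hz)
    (fun g z hz => Double.grp_mul_mem ρ β b g hz) (fun f z hz => Double.iD_mul_mem ρ β b f hz) x
  have h1 : (1 : Double ρ β (wedge V) (wedge (Module.Dual ℂ V))) ∈ Double.tripleSpan ρ β b :=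
    Submodule.subset_span ⟨1, 1, 1, by simp only [Double.grp, map_one, mul_one]⟩
  simpa using h 1 h1

/-- The products `p g q` span the double. -/
theorem Double.exists_eq_sum_triple [Fintype G]
    (x : Double ρ β (wedge V) (wedge (Module.Dual ℂ V))) :
    ∃ z : G → MvPolynomial ι ℂ ⊗[ℂ] MvPolynomial ι ℂ,
      x = ∑ g, Double.triple ρ β b g (z g) := by
  classical
  have hx := Double.mem_tripleSpan ρ β b x
  induction hx using Submodule.span_induction with
  | mem x hx =>
    obtain ⟨p, g, q, rfl⟩ := hx
    refine ⟨Pi.single g (p ⊗ₜ q), ?_⟩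
    rw [Finset.sum_eq_single g]
    · simp
    · intro h _ hne
      rw [Pi.single_eq_of_ne hne, map_zero]
    · simp
  | zero => exact ⟨0, by simp⟩
  | add x y _ _ hx hy =>
    obtain ⟨z, hz⟩ := hx
    obtain ⟨w, hw⟩ := hy
    exact ⟨z + w, by simp only [hz, hw, Pi.add_apply, map_add, Finset.sum_add_distrib]⟩
  | smul a x _ hx =>
    obtain ⟨z, hz⟩ := hx
    exact ⟨a • z, by simp only [hz, Pi.smul_apply, map_smul, Finset.smul_sum]⟩

/-- A criterion for injectivity on the double by matrix coefficients. -/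
theorem Double.injective_of_coefficients [Fintype G] [DecidableEq G] {B : Type*} [Ring B]
    [Algebra ℂ B] (φ : Double ρ β (wedge V) (wedge (Module.Dual ℂ V)) →ₐ[ℂ] B)
    (l : (ι → ℂ) → (ι → ℂ) → G → B →ₗ[ℂ] ℂ)
    (hl : ∀ a c g h p q, l a c h
      (φ (Double.polyV ρ β b p * Double.grp ρ β g * Double.polyD ρ β b q)) =
        if g = h then MvPolynomial.eval a p * MvPolynomial.eval c q else 0) :
    Function.Injective φ := by
  rw [injective_iff_map_eq_zero]
  intro x hx
  obtain ⟨z, rfl⟩ := Double.exists_eq_sum_triple ρ β b x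
  have key : ∀ a c g h z, l a c h (φ (Double.triple ρ β b g z)) =
      if g = h then evalPair a c z else 0 := by
    intro a c g h z
    induction z using TensorProduct.induction_on with
    | zero => simp
    | tmul p q => rw [Double.triple_tmul, hl, evalPair_tmul]
    | add z w hz hw =>
      simp only [map_add, hz, hw]
      split_ifs <;> simp
  have hz : ∀ h, z h = 0 := fun h => eq_zero_of_evalPair_eq_zero fun a c => by
    have := congrArg (l a c h) hx
    simpa [map_sum, key] using this
  simp [hz]

end Spanning

/-! ### Matrix coefficients and injectivity -/

section Injectivity

variable {V : Type*} [AddCommGroup V] [Module ℂ V] {G : Subgroup (V ≃ₗ[ℂ] V)} (R : Roots G)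

/-- The functional `a ⊗ w ↦ a(η) w(k)` on the standard module. -/
def Roots.coeff (η : Module.Dual ℂ (Y G)) (k : G) : R.Std →ₗ[ℂ] ℂ :=
  Roots.Std.lift ((LinearMap.mul ℂ ℂ).compl₁₂ (R.evalAt η).toLinearMap (LinearMap.proj k))

@[simp] theorem Roots.coeff_tm (η : Module.Dual ℂ (Y G)) (k : G) (a : R.QuadAlg) (w : G → ℂ) :
    R.coeff η k (R.tm a w) = R.evalAt η a * w k := rfl

theorem Roots.coeff_stdY (η : Module.Dual ℂ (Y G)) (k : G) (y : Y G) (x : R.Std) :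
    R.coeff η k (R.stdY y x) = η y * R.coeff η k x := by
  have : R.coeff η k ∘ₗ R.stdY y = η y • R.coeff η k :=
    Roots.Std.ext fun a w => by simp [mul_assoc]
  exact LinearMap.congr_fun this x

variable [Finite G]

@[simp] theorem Roots.stdAct_iV (t : ℂ) (ξ y : Y G) :
    R.stdAct t ξ (Double.iV _ _ _ _ y) = R.stdY y := Double.Hom.lift_iV _ _

@[simp] theorem Roots.stdAct_iG (t : ℂ) (ξ : Y G) (a : MonoidAlgebra ℂ G) :
    R.stdAct t ξ (Double.iG _ _ _ _ a) = R.stdGAlg a := Double.Hom.lift_iG _ _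

@[simp] theorem Roots.stdAct_iD (t : ℂ) (ξ : Y G) (f : Module.Dual ℂ (Y G)) :
    R.stdAct t ξ (Double.iD _ _ _ _ f) = R.stdD t ξ f := Double.Hom.lift_iD _ _

variable [FiniteDimensional ℂ V]

/-- Acting on `1 ⊗ δ_1`, the factor `q` gives the scalar `q(y)`, then `g` gives `1 ⊗ δ_g`, and the
coefficient functional turns `p` into `p(x)`. -/
theorem Roots.embedding_injective (c : ClassFun G) {t t' k : ℂ}
    (hk : ∀ v, R.toV (R.ofV c v) = k • v) (ht : t = t' * k) (hk0 : k ≠ 0) :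
    Function.Injective (R.embedding c hk ht) := by
  classical
  have := Fintype.ofFinite G
  let b := Module.finBasis ℂ V
  -- The factor `k⁻¹` in `η` and `ξ` undoes `toV ∘ ofV = k`, so that they restrict to the points of
  -- `V*` and `V` with coordinates `x`. This is where `k ≠ 0` enters.
  let η : (Fin (Module.finrank ℂ V) → ℂ) → Module.Dual ℂ (Y G) :=
    fun x => k⁻¹ • (b.constr ℂ x ∘ₗ R.toV)
  let ξ : (Fin (Module.finrank ℂ V) → ℂ) → Y G := fun x => k⁻¹ • R.ofV c (b.equivFun.symm x)
  have hη : ∀ x i, η x (R.ofV c (b i)) = x i := fun x i => by simp [η, hk, hk0]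
  have hξ : ∀ x i, R.toV.dualMap (b.coord i) (ξ x) = x i := fun x i => by
    have h : R.toV (ξ x) = b.equivFun.symm x := by
      simp only [ξ, map_smul, hk, smul_smul, inv_mul_cancel₀ hk0, one_smul]
    rw [LinearMap.dualMap_apply, h]
    exact congrFun (b.equivFun.apply_symm_apply x) i
  -- On functions, `f` multiplies the value at `h` by `f(h ξ)`; support at `h = 1` makes `1 ⊗ w` a
  -- joint eigenvector.
  let w : G → ℂ := Pi.single 1 1
  refine Double.injective_of_coefficients _ _ b (R.embedding c hk ht)
    (fun x y h => R.coeff (η x) h ∘ₗ LinearMap.applyₗ (R.tm 1 w) ∘ₗ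
      (R.stdAct t' (ξ y)).toLinearMap) fun x y g h p q => ?_
  let A := (R.stdAct t' (ξ y)).comp (R.embedding c hk ht)
  have hV : ∀ i, A (Double.polyV _ _ b (MvPolynomial.X i)) = R.stdY (R.ofV c (b i)) := fun i => by
    rw [Double.polyV_X]
    simp [A, Roots.embedding]
  have hD : ∀ i, A (Double.polyD _ _ b (MvPolynomial.X i)) (R.tm 1 w) = y i • R.tm 1 w := by
    intro i
    have h1 : A (Double.polyD _ _ b (MvPolynomial.X i)) =
        R.stdD t' (ξ y) (R.toV.dualMap (b.coord i)) := by
      rw [Double.polyD_X]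
      simp [A, Roots.embedding]
    rw [h1, R.stdD_one_tm, ← map_smul]
    congr 1
    ext h
    rw [R.charAct_apply]
    rcases eq_or_ne h 1 with rfl | hne
    · rw [map_one, Module.End.one_apply, hξ]
      rfl
    · simp [w, hne]
  have hG : A (Double.grp _ _ g) = R.stdG g := by
    rw [Double.grp]
    simp only [A, AlgHom.comp_apply, Roots.embedding, Double.Hom.lift_iG]
    rw [R.stdAct_iG, R.stdGAlg_of]
  change R.coeff (η x) h (A _ (R.tm 1 w)) = _
  have h1 := apply_eq_eval_smul (A.comp (Double.polyD _ _ b)) (v := R.tm 1 w) hD q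
  have h2 := apply_eq_eval_mul (A.comp (Double.polyV _ _ b)) (l := R.coeff (η x) h) (μ := x)
    (fun i z => by
      rw [AlgHom.comp_apply, hV, R.coeff_stdY, hη]) p
  rw [map_mul, map_mul, Module.End.mul_apply, Module.End.mul_apply, hG]
  rw [AlgHom.comp_apply] at h1
  rw [h1, map_smul]
  refine (h2 _).trans ?_
  rw [map_smul, R.stdG_tm, R.coeff_tm, map_one, map_one, translate_apply]
  have hw : w (g⁻¹ * h) = if g = h then 1 else 0 := by
    simp [w, Pi.single_apply, inv_mul_eq_one]
  rw [hw]
  split_ifs <;> simp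

end Injectivity

end CherednikEmbedding

end

open CherednikEmbedding in
theorem mainTheorem10 {V : Type*} [AddCommGroup V] [Module ℂ V] [FiniteDimensional ℂ V]
    (G : Subgroup (V ≃ₗ[ℂ] V)) [Finite G] [Nontrivial G]
    (hirr : (natRep G).IsIrreducible)
    (hgen : Subgroup.closure {s : G | IsComplexReflection (s : V ≃ₗ[ℂ] V)} = ⊤)
    (R : Roots G) :
    ∃ κ : ClassFun G →ₗ[ℂ] ℂ, κ ≠ 0 ∧
      (∀ (c : ClassFun G) (v : V),
        ∑ s : Refl G, (c : Refl G → ℂ) s • (v - (s.1 : V ≃ₗ[ℂ] V) v) = κ c • v) ∧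
      ∀ (t : ℂ) (c : ClassFun G), t ≠ 0 → κ c ≠ 0 →
        ∃ (t' : ℂ) (Φ : Cherednik G t c →ₐ[ℂ] R.DeformedDouble t'),
          Function.Injective Φ ∧
            ∀ x : Gens G V, Φ (cherednikι G t c x) = R.deformedι t' (R.M c x) := by
  -- Without reflections the generated group would be trivial.
  have hne : Nonempty (Refl G) := by
    by_contra h
    have : {s : G | IsComplexReflection (s : V ≃ₗ[ℂ] V)} = ∅ :=
      Set.eq_empty_of_forall_notMem fun s hs => h ⟨⟨s, hs⟩⟩
    rw [this, Subgroup.closure_empty] at hgen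
    exact bot_ne_top hgen
  have hk := R.toV_ofV_eq_kappa_smul hirr
  refine ⟨R.kappa, R.kappa_ne_zero hirr, fun c v => ?_, fun t c _ hc => ?_⟩
  · rw [← hk, R.toV_ofV]
    rfl
  · have ht : t = t / R.kappa c * R.kappa c := (div_mul_cancel₀ t hc).symm
    exact ⟨t / R.kappa c, R.embedding c (hk c) ht, R.embedding_injective c (hk c) ht hc,
      R.embedding_ι c (hk c) ht⟩
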